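/- All objects are $C^\infty$ germs at the origin of $\mathbb R^2$; $\mathcal E$ is the ring of smooth function germs, and "non-zero function" means a nowhere vanishing germ. Let $a=a_2^-=x\,dx-y\,dy$ and $X_a=y\frac{\partial}{\partial x}+x\frac{\partial}{\partial y}$. Vector fields $X_1,X_2$ are orbitally $a$-conjugate, $X_1\sim X_2$, if there are a diffeomorphism $\phi:(\mathbb R^2,0)\to(\mathbb R^2,0)$ and non-zero functions $k,h$ with $a=k\cdot\phi^*a$ and $X_1=h\cdot\phi^*X_2$. For $f\in\mathcal E$ put $\operatorname{codim}(f)=\operatorname{codim}(f\cdot X_a)=\dim_{\mathbb R}\mathcal E/\langle f,\mathcal L_{X_a}f\rangle$. The curve $\{f=0\}$ is regular at the origin if $f(0)=0$ and $d_0f\neq0$. The germ $f$ has the property of zeros if every smooth germ vanishing on $\{f=0\}$ is a multiple of $f$ in $\mathcal E$. $j^kf$ is the Taylor polynomial of $f$ of degree $k$ at the origin. Theorem. Let $f\in\mathcal E$ and $X=f\cdot X_a$. Then $x^2-y^2$ is a first integral of $X$, and: 1. If $f$ has the property of zeros and the origin is the only zero of $X$, then $X\sim X_a$. This equivalence class has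 codimension $0$ in $\ker(a)$: every $g\in\mathcal E$ with $g\cdot X_a\sim X_a$ satisfies $\operatorname{codim}(g\cdot X_a)=0$. 2. If the curve $\{f=0\}$ is regular at the origin and $\operatorname{codim}(f)=1$, then $X\sim x\cdot X_a$. 3. If $\operatorname{codim}(f)=k$ is finite, then $X\sim j^kf\cdot X_a$. -/

import Mathlib

open Filter Topology
open scoped ContDiff

namespace PlanarGerm

noncomputable section

/-! Germs at the origin of the plane `ℝ × ℝ` are represented by functions that are smooth near the
origin; every relation between germs is required to hold on some neighbourhood of the origin. -/

/-- `f` is `C^∞` on a neighbourhood of the origin. -/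
def SmoothNearZero {F : Type*} [NormedAddCommGroup F] [NormedSpace ℝ F] (f : ℝ × ℝ → F) : Prop :=
  ∀ᶠ p in 𝓝 (0 : ℝ × ℝ), ContDiffAt ℝ ∞ f p

/-- The ring `𝓔` of germs at the origin of smooth functions on the plane. -/
def smoothGerms : Subring (Germ (𝓝 (0 : ℝ × ℝ)) ℝ) where
  carrier := {g | ∃ f : ℝ × ℝ → ℝ, SmoothNearZero f ∧ (f : Germ (𝓝 (0 : ℝ × ℝ)) ℝ) = g}
  mul_mem' := by
    rintro _ _ ⟨f, hf, rfl⟩ ⟨g, hg, rfl⟩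
    refine ⟨f * g, ?_, rfl⟩
    filter_upwards [hf, hg] with p h₁ h₂ using h₁.mul h₂
  one_mem' := ⟨1, Eventually.of_forall fun _ => contDiffAt_const, rfl⟩
  add_mem' := by
    rintro _ _ ⟨f, hf, rfl⟩ ⟨g, hg, rfl⟩
    refine ⟨f + g, ?_, rfl⟩
    filter_upwards [hf, hg] with p h₁ h₂ using h₁.add h₂
  zero_mem' := ⟨0, Eventually.of_forall fun _ => contDiffAt_const, rfl⟩
  neg_mem' := by
    rintro _ ⟨f, hf, rfl⟩
    refine ⟨-f, ?_, rfl⟩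
    filter_upwards [hf] with p h₁ using h₁.neg

/-- Real numbers as constant germs. -/
def constGerm : ℝ →+* smoothGerms where
  toFun c := ⟨((fun _ => c : ℝ × ℝ → ℝ) : Germ (𝓝 (0 : ℝ × ℝ)) ℝ),
    fun _ => c, Eventually.of_forall fun _ => contDiffAt_const, rfl⟩
  map_one' := rfl
  map_mul' _ _ := rfl
  map_zero' := rfl
  map_add' _ _ := rfl

instance : Algebra ℝ smoothGerms := constGerm.toAlgebra

/-- The germ at the origin of a function that is smooth near the origin. -/
def germ (f : ℝ × ℝ → ℝ) (hf : SmoothNearZero f) : smoothGerms :=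
  ⟨(f : Germ (𝓝 (0 : ℝ × ℝ)) ℝ), f, hf, rfl⟩

/-- The Lie derivative of a function along a vector field. -/
def lieDeriv (X : ℝ × ℝ → ℝ × ℝ) (f : ℝ × ℝ → ℝ) (p : ℝ × ℝ) : ℝ :=
  fderiv ℝ f p (X p)

theorem SmoothNearZero.lieDeriv {X : ℝ × ℝ → ℝ × ℝ} {f : ℝ × ℝ → ℝ}
    (hX : SmoothNearZero X) (hf : SmoothNearZero f) : SmoothNearZero (lieDeriv X f) := by
  filter_upwards [hX, hf] with p h₁ h₂
  exact (h₂.fderiv_right (m := ∞) (by simp)).clm_apply h₁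

/-- The tangent space at `f` of the class of `f`: the ideal `⟨f, L_X f⟩` of `𝓔`. -/
def tangentIdeal (X : ℝ × ℝ → ℝ × ℝ) (hX : SmoothNearZero X)
    (f : ℝ × ℝ → ℝ) (hf : SmoothNearZero f) : Ideal smoothGerms :=
  Ideal.span {germ f hf, germ (lieDeriv X f) (hX.lieDeriv hf)}

/-- The codimension of `f` (equivalently, of the vector field `f • X`): the real dimension, as a
cardinal, of `𝓔 / ⟨f, L_X f⟩`. -/
def codim (X : ℝ × ℝ → ℝ × ℝ) (hX : SmoothNearZero X)
    (f : ℝ × ℝ → ℝ) (hf : SmoothNearZero f) : Cardinal :=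
  Module.rank ℝ (smoothGerms ⧸ tangentIdeal X hX f hf)

/-- `φ` represents the germ of a smooth diffeomorphism `(ℝ², 0) → (ℝ², 0)`. -/
def IsDiffeoGerm (φ : ℝ × ℝ → ℝ × ℝ) : Prop :=
  φ 0 = 0 ∧ SmoothNearZero φ ∧ ∃ ψ : ℝ × ℝ → ℝ × ℝ, ψ 0 = 0 ∧ SmoothNearZero ψ ∧
    (∀ᶠ p in 𝓝 0, ψ (φ p) = p) ∧ (∀ᶠ p in 𝓝 0, φ (ψ p) = p)

/-- A non-zero function germ: smooth, and nowhere zero near the origin. -/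
def IsNonzeroFunction (k : ℝ × ℝ → ℝ) : Prop :=
  SmoothNearZero k ∧ ∀ᶠ p in 𝓝 0, k p ≠ 0

/-- The pullback `φ^* a` of a 1-form. -/
def pullbackForm (φ : ℝ × ℝ → ℝ × ℝ) (a : ℝ × ℝ → (ℝ × ℝ →L[ℝ] ℝ)) (p : ℝ × ℝ) :
    ℝ × ℝ →L[ℝ] ℝ :=
  (a (φ p)).comp (fderiv ℝ φ p)

/-- `φ` is a conformal symmetry of `a`: `a = k • φ^* a` for some non-zero function `k`. -/
def IsConformalSymmetry (a : ℝ × ℝ → (ℝ × ℝ →L[ℝ] ℝ)) (φ : ℝ × ℝ → ℝ × ℝ) : Prop :=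
  IsDiffeoGerm φ ∧ ∃ k : ℝ × ℝ → ℝ, IsNonzeroFunction k ∧
    ∀ᶠ p in 𝓝 0, a p = k p • pullbackForm φ a p

/-- Orbital `a`-conjugacy `X₁ ∼ X₂`: there are a conformal symmetry `φ` of `a` and a non-zero
function `h` with `X₁ = h • φ^* X₂` near the origin. -/
def OrbitallyConjugate (a : ℝ × ℝ → (ℝ × ℝ →L[ℝ] ℝ)) (X₁ X₂ : ℝ × ℝ → ℝ × ℝ) : Prop :=
  ∃ φ : ℝ × ℝ → ℝ × ℝ, IsConformalSymmetry a φ ∧ ∃ h : ℝ × ℝ → ℝ, IsNonzeroFunction h ∧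
    ∀ᶠ p in 𝓝 0, X₁ p = h p • VectorField.pullback ℝ φ X₂ p

/-- The `k`-jet at the origin, as a polynomial function:
`p ↦ ∑_{m ≤ k} D^m f(0)(p, …, p) / m!`. -/
def jet (k : ℕ) (f : ℝ × ℝ → ℝ) (p : ℝ × ℝ) : ℝ :=
  ∑ m ∈ Finset.range (k + 1), (m.factorial : ℝ)⁻¹ * iteratedFDeriv ℝ m f 0 (fun _ => p)

/-- The germ of the curve `{f = 0}` is regular: it passes through the origin, and `d_0 f ≠ 0`. -/
def IsRegularCurve (f : ℝ × ℝ → ℝ) : Prop :=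
  f 0 = 0 ∧ fderiv ℝ f 0 ≠ 0

/-- The origin is the only zero of the germ of the vector field `X`. -/
def HasOnlyOneZero (X : ℝ × ℝ → ℝ × ℝ) : Prop :=
  ∀ᶠ p in 𝓝 0, X p = 0 ↔ p = 0

/-- The property of zeros: every smooth germ vanishing on the curve `{f = 0}` is a multiple
of `f`. -/
def HasPropertyOfZeros (f : ℝ × ℝ → ℝ) : Prop :=
  ∀ g : ℝ × ℝ → ℝ, SmoothNearZero g → (∀ᶠ p in 𝓝 0, f p = 0 → g p = 0) →
    ∃ h : ℝ × ℝ → ℝ, SmoothNearZero h ∧ ∀ᶠ p in 𝓝 0, g p = h p * f p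

/-- `I` is a first integral of the germ of `X`. -/
def IsFirstIntegral (X : ℝ × ℝ → ℝ × ℝ) (I : ℝ × ℝ → ℝ) : Prop :=
  ∀ᶠ p in 𝓝 0, lieDeriv X I p = 0

/-- The 1-form `a₂⁻ = x dx - y dy`. -/
def a2minus (p : ℝ × ℝ) : ℝ × ℝ →L[ℝ] ℝ :=
  p.1 • ContinuousLinearMap.fst ℝ ℝ ℝ - p.2 • ContinuousLinearMap.snd ℝ ℝ ℝ

/-- The vector field `y ∂/∂x + x ∂/∂y` corresponding to `a₂⁻`. -/
def Xa2minus (p : ℝ × ℝ) : ℝ × ℝ := (p.2, p.1)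

/-- The defining relation `X ⌟ ω = a₂⁻`, for the volume form `ω = dy ∧ dx`. -/
theorem Xa2minus_contract (p v : ℝ × ℝ) :
    (Xa2minus p).2 * v.1 - (Xa2minus p).1 * v.2 = a2minus p v := by
  simp [Xa2minus, a2minus]

theorem smooth_Xa2minus : SmoothNearZero Xa2minus :=
  Eventually.of_forall fun _ => (contDiff_snd.prodMk contDiff_fst).contDiffAt

end

end PlanarGerm

namespace PlanarGerm

noncomputable section

/-! ### Superposition operators on spaces of continuous functions -/

section Superposition

variable {K : Type} [TopologicalSpace K] [CompactSpace K]
  {E F : Type} [NormedAddCommGroup E] [NormedSpace ℝ E] [NormedAddCommGroup F] [NormedSpace ℝ F]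

/-! Write `X` for `Xa2minus` and `δ = j^k f - f`. The core is part 3, a homotopy argument in the
style of Moser and Mather. Moving each point `p` along its own trajectory of `X`, for a time `τ p`,
preserves `x² - y²`, hence the form `a`, and carries `X` to a multiple of itself. So it suffices to
show that `f` is a unit times `j^k f` composed with such a map
(`orbitallyConjugate_of_eq_mul_comp_orbitMap`).

Codimension `k` puts every product of `k` germs vanishing at the origin into `⟨f, X f⟩`
(`prod_mem_of_rank_quotient_eq`). By Taylor's formula `δ` is a combination of such products with
coefficients that vanish at the origin, so a Nakayama argument gives `δ = α F + β X F` along the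
whole path `F = f + θ(s) δ` (`exists_homotopy_decomposition`). If the travel time has speed `-θ' β`,
the value of `F` along the motion solves a linear equation, so its endpoints differ by an
exponential factor (`exists_eq_mul_jet_hypRot`). Smoothness of `τ` in `p` comes from the inverse
function theorem on `C([0,1])`.

For part 2, the linear jet is non-zero along both null directions, and rescaling the null
coordinates, again a conformal symmetry, turns it into `x`. For part 1, both the hypotheses on the
zeros and conjugacy to `X` force `f 0 ≠ 0`, so that `f` is a unit. -/

/-- Pointwise application of a continuous family of continuous linear maps. -/
def pointwiseApply (K E F : Type) [TopologicalSpace K] [CompactSpace K] [NormedAddCommGroup E]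
    [NormedSpace ℝ E] [NormedAddCommGroup F] [NormedSpace ℝ F] :
    C(K, E →L[ℝ] F) →L[ℝ] C(K, E) →L[ℝ] C(K, F) :=
  LinearMap.mkContinuous₂
    (LinearMap.mk₂ ℝ (fun (A : C(K, E →L[ℝ] F)) (v : C(K, E)) =>
        (⟨fun t => A t (v t), A.continuous.clm_apply v.continuous⟩ : C(K, F)))
      (fun _ _ _ => by ext; simp) (fun _ _ _ => by ext; simp)
      (fun _ _ _ => by ext; simp) (fun _ _ _ => by ext; simp))
    1 (fun A v => by
      rw [ContinuousMap.norm_le _ (by positivity)]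
      intro t
      calc ‖A t (v t)‖ ≤ ‖A t‖ * ‖v t‖ := (A t).le_opNorm _
        _ ≤ 1 * ‖A‖ * ‖v‖ := by
          rw [one_mul]
          gcongr
          · exact A.norm_coe_le_norm t
          · exact v.norm_coe_le_norm t)

/-- The mean value inequality on the ball around `u t` bounds the remainder; continuity of `u ↦ f' ∘
u` in the sup norm makes the radius independent of `t`. -/
theorem hasFDerivAt_comp_left (f : C(E, F)) (f' : C(E, E →L[ℝ] F))
    (hf : ∀ x, HasFDerivAt f (f' x) x) (u : C(K, E)) :
    HasFDerivAt (fun u : C(K, E) => f.comp u) (pointwiseApply K E F (f'.comp u)) u := by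
  rw [hasFDerivAt_iff_isLittleO_nhds_zero, Asymptotics.isLittleO_iff]
  intro ε hε
  have hcont : Continuous fun u : C(K, E) => f'.comp u := f'.continuous_postcomp
  obtain ⟨δ, hδ, hball⟩ := (Metric.continuousAt_iff (f := fun u : C(K, E) => f'.comp u)).1
    (hcont.continuousAt (x := u)) ε hε
  filter_upwards [Metric.ball_mem_nhds 0 hδ] with v hv
  rw [mem_ball_zero_iff] at hv
  rw [ContinuousMap.norm_le _ (by positivity)]
  intro t
  have hbound : ∀ y ∈ Metric.ball (u t) δ, ‖f' y - f' (u t)‖ ≤ ε := by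
    intro y hy
    -- Translating `u` by a constant gives a nearby function with value `y` at `t`, so the sup-norm
    -- estimate can be read at `y`.
    have h1 : dist (u + ContinuousMap.const K (y - u t)) u < δ := by
      rw [dist_eq_norm, add_sub_cancel_left, ContinuousMap.norm_lt_iff _ hδ]
      intro s
      simpa [dist_eq_norm] using hy
    have h2 := (ContinuousMap.dist_apply_le_dist t).trans_lt (hball h1)
    simp only [ContinuousMap.comp_apply, ContinuousMap.add_apply, ContinuousMap.const_apply,
      add_sub_cancel, dist_eq_norm] at h2
    exact h2.le
  have hvt : ‖v t‖ < δ := (v.norm_coe_le_norm t).trans_lt hv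
  have h := (convex_ball (u t) δ).norm_image_sub_le_of_norm_hasFDerivWithin_le'
    (fun x _ => (hf x).hasFDerivWithinAt) hbound (Metric.mem_ball_self hδ)
    (y := u t + v t) (by simpa [dist_eq_norm] using hvt)
  simp only [add_sub_cancel_left] at h
  calc _ = ‖f (u t + v t) - f (u t) - f' (u t) (v t)‖ := rfl
    _ ≤ ε * ‖v t‖ := h
    _ ≤ ε * ‖v‖ := by gcongr; exact v.norm_coe_le_norm t

/-- The derivative is again a superposition operator, but with values in `E →L[ℝ] F`; hence the
induction over all targets `F` at once. -/
theorem contDiff_comp_left_nat (n : ℕ) : ∀ {F : Type} [NormedAddCommGroup F] [NormedSpace ℝ F]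
    (f : C(E, F)), ContDiff ℝ ∞ f → ContDiff ℝ n (fun u : C(K, E) => f.comp u) := by
  induction n with
  | zero =>
    intro F _ _ f _
    exact contDiff_zero.2 f.continuous_postcomp
  | succ n ih =>
    intro F _ _ f hf
    have h' := (contDiff_infty_iff_fderiv.1 hf)
    let f' : C(E, E →L[ℝ] F) := ⟨fderiv ℝ f, h'.2.continuous⟩
    rw [Nat.cast_succ, contDiff_succ_iff_hasFDerivAt]
    have hL : ContDiff ℝ n (pointwiseApply K E F) := by
      apply ContinuousLinearMap.contDiff
    exact ⟨fun u => pointwiseApply K E F (f'.comp u), hL.comp (ih f' h'.2),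
      fun u => hasFDerivAt_comp_left f f' (fun x => (h'.1 x).hasFDerivAt) u⟩

/-- Composition on the left with a smooth map is a smooth operation on continuous functions. -/
theorem contDiff_comp_left (f : C(E, F)) (hf : ContDiff ℝ ∞ f) :
    ContDiff ℝ ∞ (fun u : C(K, E) => f.comp u) :=
  contDiff_infty.2 fun n => contDiff_comp_left_nat n f hf

/-- The pairing of continuous functions, as a continuous linear map. -/
def pairCLM (K E F : Type) [TopologicalSpace K] [CompactSpace K] [NormedAddCommGroup E]
    [NormedSpace ℝ E] [NormedAddCommGroup F] [NormedSpace ℝ F] :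
    (C(K, E) × C(K, F)) →L[ℝ] C(K, E × F) :=
  LinearMap.mkContinuous
    { toFun := fun u => u.1.prodMk u.2
      map_add' := fun _ _ => by ext <;> rfl
      map_smul' := fun _ _ => by ext <;> rfl } 1 (fun u => by
        rw [ContinuousMap.norm_le _ (by positivity), one_mul]
        exact fun t => max_le_max (u.1.norm_coe_le_norm t) (u.2.norm_coe_le_norm t))

@[simp]
theorem pairCLM_apply (u : C(K, E)) (v : C(K, F)) (t : K) :
    pairCLM K E F (u, v) t = (u t, v t) := rfl

/-- Constant functions, as a continuous linear map. -/
def constCLM (K E : Type) [TopologicalSpace K] [CompactSpace K] [NormedAddCommGroup E]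
    [NormedSpace ℝ E] : E →L[ℝ] C(K, E) :=
  LinearMap.mkContinuous
    { toFun := ContinuousMap.const K
      map_add' := fun _ _ => rfl
      map_smul' := fun _ _ => rfl } 1 (fun x => by
        rw [one_mul]
        exact (ContinuousMap.norm_le _ (norm_nonneg x)).2 fun _ => le_rfl)

@[simp]
theorem constCLM_apply (x : E) (t : K) : constCLM K E x t = x := rfl

end Superposition

/-! ### Integration on the unit interval -/

/-- The unit interval. -/
abbrev Unit01 : Type := Set.Icc (0 : ℝ) 1

/-- The extension of a continuous function on the unit interval, constant outside it. -/
abbrev extend01 (u : C(Unit01, ℝ)) : ℝ → ℝ := Set.IccExtend zero_le_one u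

theorem continuous_extend01 (u : C(Unit01, ℝ)) : Continuous (extend01 u) :=
  u.continuous.Icc_extend'

theorem extend01_coe (u : C(Unit01, ℝ)) (t : Unit01) : extend01 u t = u t :=
  Set.IccExtend_val _ _ _

theorem hasDerivAt_integral_extend01 (u : C(Unit01, ℝ)) (t : ℝ) :
    HasDerivAt (fun t => ∫ s in (0 : ℝ)..t, extend01 u s) (extend01 u t) t :=
  intervalIntegral.integral_hasDerivAt_right
    ((continuous_extend01 u).intervalIntegrable _ _)
    (continuous_extend01 u).stronglyMeasurable.stronglyMeasurableAtFilter
    (continuous_extend01 u).continuousAt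

/-- Integration from `0`, as a continuous linear map. -/
def primitiveCLM : C(Unit01, ℝ) →L[ℝ] C(Unit01, ℝ) :=
  LinearMap.mkContinuous
    { toFun := fun u => ⟨fun t => ∫ s in (0 : ℝ)..t, extend01 u s,
        (continuous_iff_continuousAt.2 fun t =>
          (hasDerivAt_integral_extend01 u t).continuousAt).comp continuous_subtype_val⟩
      map_add' := fun u v => by
        ext t
        exact intervalIntegral.integral_add ((continuous_extend01 u).intervalIntegrable _ _)
          ((continuous_extend01 v).intervalIntegrable _ _)
      map_smul' := fun c u => by
        ext t
        exact intervalIntegral.integral_const_mul c (extend01 u) } 1 (fun u => by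
        rw [ContinuousMap.norm_le _ (by positivity), one_mul]
        intro t
        refine (intervalIntegral.norm_integral_le_of_norm_le_const (C := ‖u‖)
          fun s _ => u.norm_coe_le_norm _).trans ?_
        rw [sub_zero, abs_of_nonneg t.2.1]
        exact mul_le_of_le_one_right (norm_nonneg _) t.2.2)

theorem primitiveCLM_apply (u : C(Unit01, ℝ)) (t : Unit01) :
    primitiveCLM u t = ∫ s in (0 : ℝ)..t, extend01 u s := rfl

/-- The inclusion of the unit interval in the line. -/
def incl01 : C(Unit01, ℝ) := ⟨Subtype.val, continuous_subtype_val⟩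

section Parametric

variable {P E F : Type} [NormedAddCommGroup P] [NormedSpace ℝ P]
  [NormedAddCommGroup E] [NormedSpace ℝ E] [NormedAddCommGroup F]

/-- The path `s ↦ V (s, u s)`. -/
def timeComp (V : C(ℝ × E, F)) (u : C(Unit01, E)) : C(Unit01, F) :=
  V.comp (pairCLM Unit01 ℝ E (incl01, u))

@[simp]
theorem timeComp_apply (V : C(ℝ × E, F)) (u : C(Unit01, E)) (t : Unit01) :
    timeComp V u t = V (t, u t) := rfl

variable [NormedSpace ℝ F]

theorem contDiff_timeComp (V : C(ℝ × E, F)) (hV : ContDiff ℝ ∞ V) : ContDiff ℝ ∞ (timeComp V) :=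
  (contDiff_comp_left V hV).comp
    ((pairCLM Unit01 ℝ E).contDiff.comp (contDiff_const.prodMk contDiff_id))

/-- Integrals over the unit interval depend smoothly on parameters. -/
theorem contDiff_integral01 (f : ℝ × P → ℝ) (hf : ContDiff ℝ ∞ f) :
    ContDiff ℝ ∞ (fun p => ∫ s in (0 : ℝ)..1, f (s, p)) := by
  -- No differentiation under the integral: the map is a composite of constant paths, superposition,
  -- integration and evaluation at `1`.
  have h : (fun p => ∫ s in (0 : ℝ)..1, f (s, p)) = fun p => (ContinuousMap.evalCLM ℝ (1 : Unit01))
      (primitiveCLM (timeComp ⟨f, hf.continuous⟩ (constCLM Unit01 P p))) := by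
    ext p
    simp only [ContinuousMap.evalCLM_apply, primitiveCLM_apply, Set.Icc.coe_one]
    refine intervalIntegral.integral_congr fun s hs => ?_
    rw [Set.uIcc_of_le zero_le_one] at hs
    exact (extend01_coe (timeComp ⟨f, hf.continuous⟩ (constCLM Unit01 P p)) ⟨s, hs⟩).symm
  rw [h]
  exact (ContinuousMap.evalCLM ℝ (1 : Unit01)).contDiff.comp (primitiveCLM.contDiff.comp
    ((contDiff_timeComp ⟨f, hf.continuous⟩ hf).comp (constCLM Unit01 P).contDiff))

/-- The inverse function theorem for smooth maps, with smoothness of the local inverse on a whole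
neighbourhood. -/
theorem exists_smooth_local_inverse [CompleteSpace E] {g : E → F} {a : E}
    (hg : ∀ᶠ x in 𝓝 a, ContDiffAt ℝ ∞ g x) (hinv : (fderiv ℝ g a).IsInvertible) :
    ∃ h : F → E, h (g a) = a ∧ (∀ᶠ y in 𝓝 (g a), ContDiffAt ℝ ∞ h y) ∧
      (∀ᶠ x in 𝓝 a, h (g x) = x) ∧ ∀ᶠ y in 𝓝 (g a), g (h y) = y := by
  have hga : ContDiffAt ℝ ∞ g a := hg.self_of_nhds
  have hn : (∞ : WithTop ℕ∞) ≠ 0 := by simp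
  obtain ⟨A, hA⟩ := hinv
  have hderiv : HasFDerivAt g (A : E →L[ℝ] F) a := by
    rw [hA]
    exact (hga.differentiableAt hn).hasFDerivAt
  have hstrict : HasStrictFDerivAt g (A : E →L[ℝ] F) a := hga.hasStrictFDerivAt' hderiv hn
  let e := hstrict.toOpenPartialHomeomorph g
  have hat : g a ∈ e.target := hstrict.image_mem_toOpenPartialHomeomorph_target
  have hsymm : e.symm (g a) = a := e.left_inv hstrict.mem_toOpenPartialHomeomorph_source
  -- Smoothness of the inverse at nearby points needs an invertible derivative there, an open
  -- condition.
  have hequiv : ∀ᶠ x in 𝓝 a, (fderiv ℝ g x).IsInvertible := by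
    have hcont : ContinuousAt (fderiv ℝ g) a :=
      (hga.fderiv_right (m := ∞) (by simp)).continuousAt
    exact hcont (hA ▸ A.nhds)
  refine ⟨e.symm, hsymm, ?_, hstrict.eventually_left_inverse, hstrict.eventually_right_inverse⟩
  have htend : Tendsto e.symm (𝓝 (g a)) (𝓝 a) := by
    have := e.continuousAt_symm hat
    rwa [ContinuousAt, hsymm] at this
  filter_upwards [htend.eventually hg, htend.eventually hequiv, e.open_target.mem_nhds hat]
    with y h1 h2 h3
  obtain ⟨B, hB⟩ := h2
  refine e.contDiffAt_symm h3 (f₀' := B) ?_ h1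
  rw [hB]
  exact (h1.differentiableAt hn).hasFDerivAt

/-- Smooth dependence on parameters of the solutions of a scalar differential equation, near a
parameter at which its right-hand side vanishes. -/
theorem exists_smooth_solution [CompleteSpace P] (V : C(ℝ × (P × ℝ), ℝ)) (hV : ContDiff ℝ ∞ V)
    (hV0 : ∀ s c, V (s, 0, c) = 0) :
    ∃ τ : P → C(Unit01, ℝ), (∀ᶠ p in 𝓝 0, ContDiffAt ℝ ∞ τ p) ∧ τ 0 = 0 ∧ ∀ᶠ p in 𝓝 0,
      τ p = primitiveCLM (timeComp V (pairCLM Unit01 P ℝ (constCLM Unit01 P p, τ p))) := by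
  -- Zeros of `G` are the solutions of the integral equation. Since `V` vanishes at parameter `0`,
  -- `G (0, u) = u`, so the partial derivative in `u` is the identity.
  let G : P × C(Unit01, ℝ) → C(Unit01, ℝ) := fun q =>
    q.2 - primitiveCLM (timeComp V (pairCLM Unit01 P ℝ (constCLM Unit01 P q.1, q.2)))
  have hG : ContDiff ℝ ∞ G := contDiff_snd.sub (primitiveCLM.contDiff.comp
    ((contDiff_timeComp V hV).comp ((pairCLM Unit01 P ℝ).contDiff.comp
      (((constCLM Unit01 P).contDiff.comp contDiff_fst).prodMk contDiff_snd))))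
  have hG0 : ∀ u, G (0, u) = u := by
    intro u
    have : timeComp V (pairCLM Unit01 P ℝ (constCLM Unit01 P 0, u)) = 0 := by
      ext t
      simp only [timeComp_apply, pairCLM_apply, constCLM_apply, hV0, ContinuousMap.zero_apply]
    simp only [G]
    rw [this, map_zero, sub_zero]
  have hGd : HasFDerivAt G (fderiv ℝ G 0) 0 := (hG.differentiable (by simp) _).hasFDerivAt
  have hderiv : ∀ u, fderiv ℝ G 0 (0, u) = u := by
    have h1 : HasFDerivAt (fun u : C(Unit01, ℝ) => G (0, u))
        (fderiv ℝ G 0 ∘L .inr ℝ P C(Unit01, ℝ)) 0 :=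
      HasFDerivAt.comp (0 : C(Unit01, ℝ)) (g := G) hGd
        (ContinuousLinearMap.inr ℝ P C(Unit01, ℝ)).hasFDerivAt
    simp only [hG0] at h1
    exact fun u => DFunLike.congr_fun (h1.unique (hasFDerivAt_id _)) u
  -- Adjoining the parameter reduces the implicit function theorem to the inverse function theorem;
  -- the derivative is block triangular with identity diagonal blocks.
  let g : P × C(Unit01, ℝ) → P × C(Unit01, ℝ) := fun q => (q.1, G q)
  have hg : ContDiff ℝ ∞ g := contDiff_fst.prodMk hG
  have hgd : HasFDerivAt g ((ContinuousLinearMap.fst ℝ P C(Unit01, ℝ)).prod (fderiv ℝ G 0)) 0 :=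
    hasFDerivAt_fst.prodMk hGd
  have hg0 : g 0 = 0 := Prod.ext rfl (hG0 0)
  have hsplit : ∀ q : P × C(Unit01, ℝ), fderiv ℝ G 0 q = fderiv ℝ G 0 (q.1, 0) + q.2 := by
    intro q
    conv_rhs => rw [← hderiv q.2, ← map_add]
    simp
  have hinv : (fderiv ℝ g 0).IsInvertible := by
    rw [hgd.fderiv]
    refine ⟨ContinuousLinearEquiv.equivOfInverse
      ((ContinuousLinearMap.fst ℝ P C(Unit01, ℝ)).prod (fderiv ℝ G 0))
      ((ContinuousLinearMap.fst ℝ P C(Unit01, ℝ)).prod (ContinuousLinearMap.snd ℝ P C(Unit01, ℝ) -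
        fderiv ℝ G 0 ∘L .inl ℝ P C(Unit01, ℝ) ∘L .fst ℝ P C(Unit01, ℝ))) ?_ ?_, rfl⟩
    · intro q
      refine Prod.ext rfl ?_
      simp [hsplit q]
    · intro q
      refine Prod.ext rfl ?_
      simp [hsplit (q.1, q.2 - fderiv ℝ G 0 (q.1, 0))]
  obtain ⟨h, h0, hsm, -, hr⟩ := exists_smooth_local_inverse
    (Eventually.of_forall fun _ => hg.contDiffAt) hinv
  rw [hg0] at h0 hsm hr
  have htend : Tendsto (fun p : P => (p, (0 : C(Unit01, ℝ)))) (𝓝 0) (𝓝 0) :=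
    (Continuous.prodMk_left (0 : C(Unit01, ℝ))).tendsto' _ _ rfl
  refine ⟨fun p => (h (p, 0)).2, ?_, by simp [show h (0, 0) = 0 from h0], ?_⟩
  · filter_upwards [htend.eventually hsm] with p hp
    exact contDiff_snd.contDiffAt.comp p
      (hp.comp p (contDiff_id.prodMk contDiff_const).contDiffAt)
  · filter_upwards [htend.eventually hr] with p hp
    have h1 : (h (p, 0)).1 = p := congrArg Prod.fst hp
    have h2 : G (h (p, 0)) = 0 := congrArg Prod.snd hp
    have h3 := sub_eq_zero.1 h2
    rwa [h1] at h3

end Parametric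

/-! ### Global representatives of germs -/

/-- Multiply `p` by a bump function. Precomposition with `r` makes data given on `U` global without
changing germs at the origin. -/
theorem exists_smooth_retraction {U : Set (ℝ × ℝ)} (hU : U ∈ 𝓝 (0 : ℝ × ℝ)) :
    ∃ r : ℝ × ℝ → ℝ × ℝ, ContDiff ℝ ∞ r ∧ (∀ p, r p ∈ U) ∧ ∀ᶠ p in 𝓝 0, r p = p := by
  obtain ⟨ε, hε, hball⟩ := Metric.mem_nhds_iff.1 hU
  let χ : ContDiffBump (0 : ℝ × ℝ) := ⟨ε / 2, ε, half_pos hε, half_lt_self hε⟩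
  refine ⟨fun p => χ p • p, χ.contDiff.smul contDiff_id, fun p => hball ?_, ?_⟩
  · rw [mem_ball_zero_iff]
    by_cases hp : ‖p‖ < ε
    · rw [norm_smul, Real.norm_of_nonneg χ.nonneg]
      exact (mul_le_of_le_one_left (norm_nonneg p) χ.le_one).trans_lt hp
    · have hχ : χ p = 0 := χ.zero_of_le_dist (by simpa using hp)
      simpa [hχ] using hε
  · filter_upwards [χ.eventuallyEq_one] with p hp
    simp [hp]

theorem SmoothNearZero.exists_contDiff {F : Type} [NormedAddCommGroup F] [NormedSpace ℝ F]
    {f : ℝ × ℝ → F} (hf : SmoothNearZero f) :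
    ∃ g : ℝ × ℝ → F, ContDiff ℝ ∞ g ∧ g =ᶠ[𝓝 0] f := by
  obtain ⟨r, hr, hrU, hr0⟩ := exists_smooth_retraction hf
  refine ⟨f ∘ r, contDiff_iff_contDiffAt.2 fun p => ?_, ?_⟩
  · exact ContDiffAt.comp (g := f) p (hrU p) hr.contDiffAt
  · filter_upwards [hr0] with p hp
    simp [hp]

theorem _root_.ContDiff.smoothNearZero {F : Type} [NormedAddCommGroup F] [NormedSpace ℝ F]
    {f : ℝ × ℝ → F} (hf : ContDiff ℝ ∞ f) : SmoothNearZero f :=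
  Eventually.of_forall fun _ => hf.contDiffAt

theorem SmoothNearZero.contDiffAt_zero {F : Type} [NormedAddCommGroup F] [NormedSpace ℝ F]
    {f : ℝ × ℝ → F} (hf : SmoothNearZero f) : ContDiffAt ℝ ∞ f 0 :=
  hf.self_of_nhds

/-! ### Null coordinates -/

/-- The null coordinates `x + y` and `x - y`. -/
def nullCoord (i : Fin 2) (p : ℝ × ℝ) : ℝ := ![p.1 + p.2, p.1 - p.2] i

/-- The basis dual to the null coordinates. -/
def nullVec (i : Fin 2) : ℝ × ℝ := ![(1 / 2, 1 / 2), (1 / 2, -1 / 2)] i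

/-- The eigenvalues of the null coordinates under the Lie derivative along `Xa2minus`. -/
def nullWeight (i : Fin 2) : ℝ := ![1, -1] i

theorem sum_nullCoord_smul_nullVec (p : ℝ × ℝ) : ∑ i, nullCoord i p • nullVec i = p := by
  ext <;> simp [nullCoord, nullVec] <;> ring

theorem contDiff_nullCoord (i : Fin 2) : ContDiff ℝ ∞ (nullCoord i) := by
  fin_cases i
  · exact contDiff_fst.add contDiff_snd
  · exact contDiff_fst.sub contDiff_snd

theorem nullCoord_zero (i : Fin 2) : nullCoord i 0 = 0 := by
  fin_cases i <;> simp [nullCoord]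

/-- Monomials in the null coordinates, indexed by words. -/
def nullMonomial {k : ℕ} (w : Fin k → Fin 2) (p : ℝ × ℝ) : ℝ := ∏ j, nullCoord (w j) p

theorem contDiff_nullMonomial {k : ℕ} (w : Fin k → Fin 2) : ContDiff ℝ ∞ (nullMonomial w) :=
  contDiff_prod fun j _ => contDiff_nullCoord (w j)

theorem _root_.ContDiff.lieDeriv {f : ℝ × ℝ → ℝ} (hf : ContDiff ℝ ∞ f) :
    ContDiff ℝ ∞ (lieDeriv Xa2minus f) :=
  (contDiff_infty_iff_fderiv.1 hf).2.clm_apply (contDiff_snd.prodMk contDiff_fst)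

theorem lieDeriv_zero_apply (f : ℝ × ℝ → ℝ) : lieDeriv Xa2minus f 0 = 0 := by
  have : Xa2minus 0 = 0 := rfl
  simp [lieDeriv, this]

theorem lieDeriv_add {f g : ℝ × ℝ → ℝ} {p : ℝ × ℝ} (X : ℝ × ℝ → ℝ × ℝ)
    (hf : DifferentiableAt ℝ f p) (hg : DifferentiableAt ℝ g p) :
    lieDeriv X (fun q => f q + g q) p = lieDeriv X f p + lieDeriv X g p := by
  simp [lieDeriv, fderiv_fun_add hf hg]

theorem lieDeriv_mul {f g : ℝ × ℝ → ℝ} {p : ℝ × ℝ} (X : ℝ × ℝ → ℝ × ℝ)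
    (hf : DifferentiableAt ℝ f p) (hg : DifferentiableAt ℝ g p) :
    lieDeriv X (fun q => f q * g q) p = lieDeriv X f p * g p + f p * lieDeriv X g p := by
  simp [lieDeriv, fderiv_fun_mul hf hg]
  ring

theorem lieDeriv_const_mul {f : ℝ × ℝ → ℝ} {p : ℝ × ℝ} (X : ℝ × ℝ → ℝ × ℝ) (c : ℝ)
    (hf : DifferentiableAt ℝ f p) :
    lieDeriv X (fun q => c * f q) p = c * lieDeriv X f p := by
  simp [lieDeriv, fderiv_const_mul hf]

theorem lieDeriv_sum {ι : Type} (s : Finset ι) {f : ι → ℝ × ℝ → ℝ} {p : ℝ × ℝ}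
    (X : ℝ × ℝ → ℝ × ℝ) (hf : ∀ i ∈ s, DifferentiableAt ℝ (f i) p) :
    lieDeriv X (fun q => ∑ i ∈ s, f i q) p = ∑ i ∈ s, lieDeriv X (f i) p := by
  simp [lieDeriv, fderiv_fun_sum hf]

theorem lieDeriv_prod_eigen {ι : Type} [DecidableEq ι] (s : Finset ι) {f : ι → ℝ × ℝ → ℝ}
    (c : ι → ℝ) {p : ℝ × ℝ} (X : ℝ × ℝ → ℝ × ℝ) (hd : ∀ i, DifferentiableAt ℝ (f i) p)
    (hf : ∀ i, lieDeriv X (f i) p = c i * f i p) :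
    lieDeriv X (fun q => ∏ i ∈ s, f i q) p = (∑ i ∈ s, c i) * ∏ i ∈ s, f i p := by
  induction s using Finset.induction with
  | empty => simp [lieDeriv]
  | insert a s ha ih =>
    simp only [Finset.prod_insert ha, Finset.sum_insert ha]
    rw [lieDeriv_mul X (hd a) (HasFDerivAt.finsetProd fun i _ => (hd i).hasFDerivAt).differentiableAt, ih, hf]
    ring

theorem lieDeriv_nullCoord (i : Fin 2) (p : ℝ × ℝ) :
    lieDeriv Xa2minus (nullCoord i) p = nullWeight i * nullCoord i p := by
  fin_cases i
  · have h : HasFDerivAt (nullCoord 0) (.fst ℝ ℝ ℝ + .snd ℝ ℝ ℝ) p :=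
      hasFDerivAt_fst.add hasFDerivAt_snd
    simp [lieDeriv, h.fderiv, Xa2minus, nullWeight, nullCoord, add_comm]
  · have h : HasFDerivAt (nullCoord 1) (.fst ℝ ℝ ℝ - .snd ℝ ℝ ℝ) p :=
      hasFDerivAt_fst.sub hasFDerivAt_snd
    simp [lieDeriv, h.fderiv, Xa2minus, nullWeight, nullCoord]

theorem lieDeriv_nullMonomial {k : ℕ} (w : Fin k → Fin 2) (p : ℝ × ℝ) :
    lieDeriv Xa2minus (nullMonomial w) p = (∑ j, nullWeight (w j)) * nullMonomial w p :=
  lieDeriv_prod_eigen Finset.univ _ _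
    (fun j => (contDiff_nullCoord (w j)).differentiable (by simp) p)
    fun j => lieDeriv_nullCoord (w j) p

/-! ### Taylor's formula -/

theorem jet_congr {f g : ℝ × ℝ → ℝ} (h : f =ᶠ[𝓝 0] g) (k : ℕ) : jet k f = jet k g := by
  ext p
  exact Finset.sum_congr rfl fun m _ => by rw [(h.iteratedFDeriv ℝ m).self_of_nhds]

theorem contDiff_jet (k : ℕ) (f : ℝ × ℝ → ℝ) : ContDiff ℝ ∞ (jet k f) :=
  ContDiff.sum fun m _ => contDiff_const.mul
    ((iteratedFDeriv ℝ m f 0).contDiff.comp (contDiff_pi.2 fun _ => contDiff_id))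

/-- Taylor's formula: the difference of a smooth function and its `k`-jet is a combination of
monomials of degree `k`, with coefficients that vanish at the origin. -/
theorem exists_jet_sub_eq (k : ℕ) {f : ℝ × ℝ → ℝ} (hf : ContDiff ℝ ∞ f) :
    ∃ c : (Fin k → Fin 2) → ℝ × ℝ → ℝ, (∀ w, ContDiff ℝ ∞ (c w)) ∧ (∀ w, c w 0 = 0) ∧
      ∀ p, jet k f p - f p = ∑ w, c w p * nullMonomial w p := by
  -- The integrand of the Taylor remainder: of the `k + 1` arguments `p`, `k` are expanded in the
  -- null basis and one is kept, which makes the coefficients vanish at the origin.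
  let T : (Fin k → Fin 2) → ℝ × (ℝ × ℝ) → ℝ := fun w q => (1 - q.1) ^ k *
    (fderiv ℝ (iteratedFDeriv ℝ k f) (q.1 • q.2) q.2) (fun j => nullVec (w j))
  have hT : ∀ w, ContDiff ℝ ∞ (T w) := by
    intro w
    have h1 : ContDiff ℝ ∞ (fderiv ℝ (iteratedFDeriv ℝ k f)) :=
      (contDiff_infty_iff_fderiv.1 (hf.iteratedFDeriv_right (m := ∞) (i := k) (by exact_mod_cast le_top))).2
    have h2 : ContDiff ℝ ∞ fun q : ℝ × (ℝ × ℝ) =>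
        fderiv ℝ (iteratedFDeriv ℝ k f) (q.1 • q.2) q.2 :=
      (h1.comp (contDiff_fst.smul contDiff_snd)).clm_apply contDiff_snd
    exact ((contDiff_const.sub contDiff_fst).pow k).mul
      ((ContinuousMultilinearMap.apply ℝ (fun _ : Fin k => ℝ × ℝ) ℝ
        (fun j => nullVec (w j))).contDiff.comp h2)
  refine ⟨fun w p => -(k.factorial : ℝ)⁻¹ * ∫ t in (0 : ℝ)..1, T w (t, p),
    fun w => contDiff_const.mul (contDiff_integral01 (T w) (hT w)), fun w => by simp [T], ?_⟩
  intro p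
  have h := map_add_eq_sum_add_integral_iteratedFDeriv (f := f) (x := 0) (y := p) (n := k)
    fun t _ => hf.contDiffAt.of_le (by exact_mod_cast le_top)
  have hexp : ∀ t : ℝ, (1 - t) ^ k • iteratedFDeriv ℝ (k + 1) f (0 + t • p) (fun _ => p) =
      ∑ w : Fin k → Fin 2, nullMonomial w p * T w (t, p) := by
    intro t
    rw [iteratedFDeriv_succ_apply_left, zero_add]
    have : (Fin.tail fun _ : Fin (k + 1) => p) =
        fun _ : Fin k => ∑ i, nullCoord i p • nullVec i := by
      ext1 j
      rw [sum_nullCoord_smul_nullVec]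
      rfl
    rw [this, ContinuousMultilinearMap.map_sum, Finset.smul_sum]
    refine Finset.sum_congr rfl fun w _ => ?_
    rw [ContinuousMultilinearMap.map_smul_univ]
    simp only [T, smul_eq_mul, nullMonomial]
    ring
  simp only [hexp] at h
  have hint : ∀ w ∈ Finset.univ, IntervalIntegrable (fun t => nullMonomial w p * T w (t, p))
      MeasureTheory.volume 0 1 := fun w _ => Continuous.intervalIntegrable
    (continuous_const.mul ((hT w).continuous.comp (Continuous.prodMk_left p))) _ _
  rw [intervalIntegral.integral_finsetSum hint] at h
  simp only [intervalIntegral.integral_const_mul, smul_eq_mul, zero_add] at h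
  rw [h, jet, sub_add_cancel_left, Finset.mul_sum, ← Finset.sum_neg_distrib]
  exact Finset.sum_congr rfl fun w _ => by ring

/-! ### Ideals of finite codimension -/

/-- The `k + 1` partial products are dependent modulo `I`. Factoring out the shortest one with
non-zero coefficient leaves a unit, by `h𝔪`; so that product lies in `I`, and the full product is a
multiple of it. -/
theorem prod_mem_of_rank_quotient_eq {R : Type} [CommRing R] [Algebra ℝ R] (I 𝔪 : Ideal R)
    (h𝔪 : ∀ c : ℝ, c ≠ 0 → ∀ x ∈ 𝔪, IsUnit (algebraMap ℝ R c + x)) {k : ℕ}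
    (hI : Module.rank ℝ (R ⧸ I) = k) (x : ℕ → R) (hx : ∀ j, x j ∈ 𝔪) :
    ∏ j ∈ Finset.range k, x j ∈ I := by
  let y : ℕ → R := fun n => ∏ j ∈ Finset.range n, x j
  have hdep : ¬ LinearIndependent ℝ fun j : Fin (k + 1) => (Ideal.Quotient.mkₐ ℝ I) (y j) := by
    intro hli
    have := hli.cardinal_le_rank
    rw [hI, Cardinal.mk_fin] at this
    norm_cast at this
    omega
  obtain ⟨c, hc, i, hi⟩ := Fintype.not_linearIndependent_iff.1 hdep
  obtain ⟨j₀, hj₀, hmin⟩ := WellFounded.has_min (wellFounded_lt (α := Fin (k + 1)))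
    {j | c j ≠ 0} ⟨i, hi⟩
  have hzero : ∀ j < j₀, c j = 0 := fun j hj => by
    by_contra h
    exact hmin j h hj
  have hmul : ∀ m n, m ≤ n → y n = y m * ∏ j ∈ Finset.Ico m n, x j := fun m n hmn =>
    (Finset.prod_range_mul_prod_Ico _ hmn).symm
  have hmem : ∑ j : Fin (k + 1), c j • y j ∈ I := by
    rw [← Ideal.Quotient.eq_zero_iff_mem, ← hc]
    change Ideal.Quotient.mkₐ ℝ I _ = _
    rw [map_sum]
    simp only [map_smul]
  let z : R := ∑ j ∈ Finset.univ.erase j₀,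
    c j • ∏ i ∈ Finset.Ico (j₀ : ℕ) j, x i
  have hz : z ∈ 𝔪 := by
    refine Submodule.sum_mem _ fun j hj => ?_
    rcases lt_or_gt_of_ne (Finset.ne_of_mem_erase hj) with h | h
    · simp [hzero j h]
    · rw [Algebra.smul_def]
      refine 𝔪.mul_mem_left _ ?_
      have : (j₀ : ℕ) ∈ Finset.Ico (j₀ : ℕ) j := by simpa using h
      rw [← Finset.mul_prod_erase _ _ this]
      exact 𝔪.mul_mem_right _ (hx _)
  have hfac : ∑ j : Fin (k + 1), c j • y j = y j₀ * (algebraMap ℝ R (c j₀) + z) := by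
    rw [← Finset.add_sum_erase _ _ (Finset.mem_univ j₀), mul_add, Finset.mul_sum,
      Algebra.smul_def, mul_comm]
    congr 1
    refine Finset.sum_congr rfl fun j hj => ?_
    rcases lt_or_gt_of_ne (Finset.ne_of_mem_erase hj) with h | h
    · simp [hzero j h]
    · rw [hmul j₀ j (by exact_mod_cast h.le), mul_smul_comm]
  rw [hfac] at hmem
  have := (Ideal.mul_unit_mem_iff_mem I (h𝔪 _ hj₀ z hz)).1 hmem
  change y k ∈ I
  rw [hmul j₀ k (by omega)]
  exact I.mul_mem_right _ this

/-- Evaluation of germs at the origin. -/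
def evalZero : smoothGerms →+* ℝ := Germ.valueRingHom.comp smoothGerms.subtype

theorem isUnit_of_evalZero_ne_zero {g : smoothGerms} (hg : evalZero g ≠ 0) : IsUnit g := by
  obtain ⟨_, f, hf, rfl⟩ := g
  have hf0 : f 0 ≠ 0 := hg
  have hne : ∀ᶠ p in 𝓝 0, f p ≠ 0 :=
    (SmoothNearZero.contDiffAt_zero hf).continuousAt.eventually_ne hf0
  have hinv : SmoothNearZero fun p => (f p)⁻¹ := by
    filter_upwards [hf, hne] with p h1 h2 using h1.inv h2
  refine IsUnit.of_mul_eq_one (germ _ hinv) (Subtype.ext (Germ.coe_eq.2 ?_))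
  filter_upwards [hne] with p hp
  exact mul_inv_cancel₀ hp

theorem germ_mem_tangentIdeal_iff {f g : ℝ × ℝ → ℝ} (hf : SmoothNearZero f)
    (hg : SmoothNearZero g) : germ g hg ∈ tangentIdeal Xa2minus smooth_Xa2minus f hf ↔
    ∃ a b : ℝ × ℝ → ℝ, ContDiff ℝ ∞ a ∧ ContDiff ℝ ∞ b ∧
      ∀ᶠ p in 𝓝 0, g p = a p * f p + b p * lieDeriv Xa2minus f p := by
  rw [tangentIdeal, Ideal.mem_span_pair]
  constructor
  · rintro ⟨⟨_, a, ha, rfl⟩, ⟨_, b, hb, rfl⟩, h⟩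
    obtain ⟨a', ha', haa⟩ := ha.exists_contDiff
    obtain ⟨b', hb', hbb⟩ := hb.exists_contDiff
    refine ⟨a', b', ha', hb', ?_⟩
    have h' := Germ.coe_eq.1 (congrArg Subtype.val h)
    filter_upwards [h', haa, hbb] with p hp h1 h2
    rw [h1, h2]
    exact hp.symm
  · rintro ⟨a, b, ha, hb, h⟩
    refine ⟨germ a ha.smoothNearZero, germ b hb.smoothNearZero, Subtype.ext (Germ.coe_eq.2 ?_)⟩
    filter_upwards [h] with p hp
    exact hp.symm

theorem exists_nullMonomial_eq {f : ℝ × ℝ → ℝ} (hf : SmoothNearZero f) {k : ℕ}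
    (hk : codim Xa2minus smooth_Xa2minus f hf = k) (w : Fin k → Fin 2) :
    ∃ a b : ℝ × ℝ → ℝ, ContDiff ℝ ∞ a ∧ ContDiff ℝ ∞ b ∧
      ∀ᶠ p in 𝓝 0, nullMonomial w p = a p * f p + b p * lieDeriv Xa2minus f p := by
  rw [← germ_mem_tangentIdeal_iff hf (contDiff_nullMonomial w).smoothNearZero]
  have h := prod_mem_of_rank_quotient_eq (tangentIdeal Xa2minus smooth_Xa2minus f hf)
    (RingHom.ker evalZero) (fun c hc x hx => isUnit_of_evalZero_ne_zero (by
      rw [map_add, RingHom.mem_ker.1 hx, add_zero]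
      exact hc)) hk
    -- The padding by `0` beyond `k` is never read: only the first `k` factors enter.
    (fun j => if h : j < k then germ (nullCoord (w ⟨j, h⟩)) (contDiff_nullCoord _).smoothNearZero
      else 0) (fun j => by
      split_ifs with h
      · exact nullCoord_zero _
      · exact Ideal.zero_mem _)
  rw [Finset.prod_range] at h
  simp only [Fin.is_lt, dif_pos, Fin.eta] at h
  convert h
  have hprod : ∀ s : Finset (Fin k), ((∏ j ∈ s, germ (nullCoord (w j))
      (contDiff_nullCoord (w j)).smoothNearZero : smoothGerms) : Germ (𝓝 (0 : ℝ × ℝ)) ℝ) =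
      ((fun p => ∏ j ∈ s, nullCoord (w j) p : ℝ × ℝ → ℝ) : Germ (𝓝 (0 : ℝ × ℝ)) ℝ) := by
    intro s
    induction s using Finset.induction with
    | empty => rfl
    | insert a s ha ih =>
      simp only [Finset.prod_insert ha]
      rw [Subring.coe_mul, ih]
      rfl
  exact Subtype.ext (hprod Finset.univ).symm

/-! ### Decomposition along the homotopy -/

theorem contDiff_det {ι E : Type} [Fintype ι] [DecidableEq ι] [NormedAddCommGroup E]
    [NormedSpace ℝ E] {A : E → Matrix ι ι ℝ} (hA : ∀ i j, ContDiff ℝ ∞ fun x => A x i j) :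
    ContDiff ℝ ∞ fun x => (A x).det := by
  simp only [Matrix.det_apply']
  exact ContDiff.sum fun σ _ => contDiff_const.mul (contDiff_prod fun i _ => hA _ _)

/-- Cramer's formula: the entries are determinants divided by a non-vanishing determinant. -/
theorem contDiff_matrix_inv {ι E : Type} [Fintype ι] [DecidableEq ι] [NormedAddCommGroup E]
    [NormedSpace ℝ E] {A : E → Matrix ι ι ℝ} (hA : ∀ i j, ContDiff ℝ ∞ fun x => A x i j)
    (hdet : ∀ x, (A x).det ≠ 0) (i j : ι) : ContDiff ℝ ∞ fun x => (A x)⁻¹ i j := by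
  simp only [Matrix.inv_def, Ring.inverse_eq_inv, Matrix.smul_apply, smul_eq_mul,
    Matrix.adjugate_apply]
  refine ((contDiff_det hA).inv hdet).mul (contDiff_det fun i' j' => ?_)
  by_cases h : i' = j
  · subst h
    simpa using contDiff_const
  · simpa [Matrix.updateRow_ne h] using hA i' j'

/-- Along the segment from a germ `f` of codimension `k` to its `k`-jet, the direction of the
segment stays in the tangent space, with coefficients that are smooth in all variables. -/
theorem exists_homotopy_decomposition {k : ℕ} {f : ℝ × ℝ → ℝ} (hf : ContDiff ℝ ∞ f)
    (hk : codim Xa2minus smooth_Xa2minus f hf.smoothNearZero = k)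
    (θ : ℝ → ℝ) (hθ : ContDiff ℝ ∞ θ) (hθ01 : ∀ s, θ s ∈ Set.Icc (0 : ℝ) 1) :
    ∃ α β : ℝ × (ℝ × ℝ) → ℝ, ContDiff ℝ ∞ α ∧ ContDiff ℝ ∞ β ∧ (∀ s, β (s, 0) = 0) ∧
      ∀ᶠ p in 𝓝 0, ∀ s, jet k f p - f p =
        α (s, p) * (f p + θ s * (jet k f p - f p)) +
        β (s, p) * lieDeriv Xa2minus (fun q => f q + θ s * (jet k f q - f q)) p := by
  choose a b ha hb hab using exists_nullMonomial_eq hf.smoothNearZero hk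
  obtain ⟨c, hc, hc0, hδ⟩ := exists_jet_sub_eq k hf
  -- Null monomials are eigenfunctions of `X`, so `X δ` is a combination of the same monomials, with
  -- coefficients `d`.
  let d : (Fin k → Fin 2) → ℝ × ℝ → ℝ := fun w p =>
    lieDeriv Xa2minus (c w) p + (∑ j, nullWeight (w j)) * c w p
  have hd : ∀ w, ContDiff ℝ ∞ (d w) := fun w =>
    (hc w).lieDeriv.add (contDiff_const.mul (hc w))
  -- With `F = f + t δ`, the germs `a w * F + b w * X F` are obtained from the monomials by the
  -- matrix `1 + t M`. As `M 0 = 0`, it is invertible near the origin, uniformly for `t` in `[0, 1]`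
  -- by compactness.
  let M : ℝ × ℝ → Matrix (Fin k → Fin 2) (Fin k → Fin 2) ℝ := fun p =>
    Matrix.of fun w v => a w p * c v p + b w p * d v p
  have hM : ∀ w v, ContDiff ℝ ∞ fun p => M p w v := fun w v =>
    ((ha w).mul (hc v)).add ((hb w).mul (hd v))
  have hM0 : M 0 = 0 := by
    ext w v
    simp [M, d, hc0, lieDeriv_zero_apply]
  have hone : ∀ w v, ContDiff ℝ ∞ fun q : (ℝ × ℝ) × ℝ => (1 + q.2 • M q.1) w v := fun w v =>
    contDiff_const.add (contDiff_snd.mul ((hM w v).comp contDiff_fst))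
  have hdet : ∀ᶠ p in 𝓝 0, ∀ t ∈ Set.Icc (0 : ℝ) 1, (1 + t • M p).det ≠ 0 := by
    refine isCompact_Icc.eventually_forall_of_forall_eventually fun t _ => ?_
    refine (contDiff_det hone).continuous.continuousAt.eventually_ne ?_
    simp [hM0]
  obtain ⟨r, hr, hrU, hr0⟩ := exists_smooth_retraction hdet
  let A : ℝ × (ℝ × ℝ) → Matrix (Fin k → Fin 2) (Fin k → Fin 2) ℝ := fun q =>
    1 + θ q.1 • M (r q.2)
  have hA : ∀ w v, ContDiff ℝ ∞ fun q => A q w v := fun w v =>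
    (hone w v).comp ((hr.comp contDiff_snd).prodMk (hθ.comp contDiff_fst))
  have hN := contDiff_matrix_inv hA fun q => hrU q.2 _ (hθ01 q.1)
  -- Solve for the monomials and substitute into `δ`; the factor `c w` makes `β` vanish at the
  -- origin.
  refine ⟨fun q => ∑ w, ∑ v, c w q.2 * (A q)⁻¹ w v * a v q.2,
    fun q => ∑ w, ∑ v, c w q.2 * (A q)⁻¹ w v * b v q.2,
    ContDiff.sum fun w _ => ContDiff.sum fun v _ =>
      (((hc w).comp contDiff_snd).mul (hN w v)).mul ((ha v).comp contDiff_snd),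
    ContDiff.sum fun w _ => ContDiff.sum fun v _ =>
      (((hc w).comp contDiff_snd).mul (hN w v)).mul ((hb v).comp contDiff_snd),
    fun s => by simp [hc0], ?_⟩
  filter_upwards [hr0, eventually_all.2 hab] with p hrp hp s
  have hdiff : ∀ {g : ℝ × ℝ → ℝ}, ContDiff ℝ ∞ g → DifferentiableAt ℝ g p := fun hg =>
    hg.differentiable (by simp) p
  have hXδ : lieDeriv Xa2minus (fun q => jet k f q - f q) p = ∑ v, d v p * nullMonomial v p := by
    simp only [hδ]
    rw [lieDeriv_sum _ (f := fun w q => c w q * nullMonomial w q) _ fun w _ => (hdiff (hc w)).mul (hdiff (contDiff_nullMonomial w))]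
    refine Finset.sum_congr rfl fun w _ => ?_
    rw [lieDeriv_mul _ (hdiff (hc w)) (hdiff (contDiff_nullMonomial w)), lieDeriv_nullMonomial]
    simp only [d]
    ring
  have hδd : DifferentiableAt ℝ (fun q => jet k f q - f q) p :=
    (hdiff (contDiff_jet k f)).sub (hdiff hf)
  have hXF : lieDeriv Xa2minus (fun q => f q + θ s * (jet k f q - f q)) p =
      lieDeriv Xa2minus f p + θ s * ∑ v, d v p * nullMonomial v p := by
    rw [lieDeriv_add _ (hdiff hf) (hδd.const_mul _), lieDeriv_const_mul _ _ hδd, hXδ]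
  have hsys : ∀ v, a v p * (f p + θ s * (jet k f p - f p)) +
      b v p * lieDeriv Xa2minus (fun q => f q + θ s * (jet k f q - f q)) p =
      (A (s, p)).mulVec (fun w => nullMonomial w p) v := by
    intro v
    simp only [A, hrp]
    rw [hXF, Matrix.add_mulVec, Matrix.one_mulVec, Matrix.smul_mulVec, Pi.add_apply,
      Pi.smul_apply, hp v, hδ]
    simp only [Matrix.mulVec, dotProduct, M, Matrix.of_apply, smul_eq_mul, add_mul,
      Finset.sum_add_distrib, mul_assoc, ← Finset.mul_sum]
    ring
  have hunit : IsUnit (A (s, p)).det := isUnit_iff_ne_zero.2 (hrU p _ (hθ01 s))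
  have hsolve : ∀ w, ∑ v, (A (s, p))⁻¹ w v * (a v p * (f p + θ s * (jet k f p - f p)) +
      b v p * lieDeriv Xa2minus (fun q => f q + θ s * (jet k f q - f q)) p) =
      nullMonomial w p := by
    intro w
    simp only [hsys]
    change ((A (s, p))⁻¹.mulVec ((A (s, p)).mulVec fun w => nullMonomial w p)) w = _
    rw [Matrix.mulVec_mulVec, Matrix.nonsing_inv_mul _ hunit, Matrix.one_mulVec]
  conv_lhs => rw [hδ]
  simp only [← hsolve, Finset.sum_mul, Finset.mul_sum, ← Finset.sum_add_distrib]
  refine Finset.sum_congr rfl fun w _ => Finset.sum_congr rfl fun v _ => ?_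
  ring

/-! ### Integration of the homotopy -/

/-- The flow of `Xa2minus`. -/
def hypRot (t : ℝ) (p : ℝ × ℝ) : ℝ × ℝ :=
  (Real.cosh t * p.1 + Real.sinh t * p.2, Real.sinh t * p.1 + Real.cosh t * p.2)

theorem hypRot_zero_left (p : ℝ × ℝ) : hypRot 0 p = p := by simp [hypRot]

theorem hypRot_zero_right (t : ℝ) : hypRot t 0 = 0 := by simp [hypRot]

theorem contDiff_hypRot : ContDiff ℝ ∞ fun q : (ℝ × ℝ) × ℝ => hypRot q.2 q.1 := by
  unfold hypRot
  fun_prop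

theorem hasDerivAt_hypRot (t : ℝ) (p : ℝ × ℝ) :
    HasDerivAt (fun t => hypRot t p) (Xa2minus (hypRot t p)) t :=
  (((Real.hasDerivAt_cosh t).mul_const p.1).add ((Real.hasDerivAt_sinh t).mul_const p.2)).prodMk
    (((Real.hasDerivAt_sinh t).mul_const p.1).add ((Real.hasDerivAt_cosh t).mul_const p.2))

theorem hasDerivAt_comp_hypRot {f : ℝ × ℝ → ℝ} (hf : ContDiff ℝ ∞ f) (p : ℝ × ℝ) {T : ℝ → ℝ}
    {T' s : ℝ} (hT : HasDerivAt T T' s) :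
    HasDerivAt (fun s => f (hypRot (T s) p)) (T' * lieDeriv Xa2minus f (hypRot (T s) p)) s := by
  have h := (hf.differentiable (by simp) (hypRot (T s) p)).hasFDerivAt.comp_hasDerivAt s
    ((hasDerivAt_hypRot (T s) p).scomp s hT)
  exact h.congr_deriv ((fderiv ℝ f (hypRot (T s) p)).map_smul T' _)

/-- A germ of finite codimension `k` is the product of a non-zero function and of its `k`-jet,
moved along the trajectories of `Xa2minus`. -/
theorem exists_eq_mul_jet_hypRot {k : ℕ} {f : ℝ × ℝ → ℝ} (hf : ContDiff ℝ ∞ f)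
    (hk : codim Xa2minus smooth_Xa2minus f hf.smoothNearZero = k) :
    ∃ τ γ : ℝ × ℝ → ℝ, SmoothNearZero τ ∧ IsNonzeroFunction γ ∧
      ∀ᶠ p in 𝓝 0, f p = γ p * jet k f (hypRot (τ p) p) := by
  -- A smooth function on the whole line, with values in `[0, 1]` and `θ 0 = 0`, `θ 1 = 1`, keeps
  -- all data globally smooth in `s`.
  let θ : ℝ → ℝ := Real.smoothTransition
  have hθ : ContDiff ℝ ∞ θ := Real.smoothTransition.contDiff
  have hθ' : ContDiff ℝ ∞ (deriv θ) := (contDiff_infty_iff_deriv.1 hθ).2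
  obtain ⟨α, β, hα, hβ, hβ0, hαβ⟩ := exists_homotopy_decomposition hf hk θ hθ
    fun s => ⟨Real.smoothTransition.nonneg s, Real.smoothTransition.le_one s⟩
  have hmove : ContDiff ℝ ∞ fun q : ℝ × ((ℝ × ℝ) × ℝ) => (q.1, hypRot q.2.2 q.2.1) :=
    contDiff_fst.prodMk (contDiff_hypRot.comp contDiff_snd)
  -- This speed cancels the `β` term of the decomposition; `W` carries the remaining `α` term.
  have hVs : ContDiff ℝ ∞ fun q : ℝ × ((ℝ × ℝ) × ℝ) =>
      -(deriv θ q.1 * β (q.1, hypRot q.2.2 q.2.1)) :=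
    ((hθ'.comp contDiff_fst).mul (hβ.comp hmove)).neg
  have hWs : ContDiff ℝ ∞ fun q : ℝ × ((ℝ × ℝ) × ℝ) =>
      deriv θ q.1 * α (q.1, hypRot q.2.2 q.2.1) :=
    (hθ'.comp contDiff_fst).mul (hα.comp hmove)
  let V : C(ℝ × ((ℝ × ℝ) × ℝ), ℝ) := ⟨_, hVs.continuous⟩
  let W : C(ℝ × ((ℝ × ℝ) × ℝ), ℝ) := ⟨_, hWs.continuous⟩
  obtain ⟨τ, hτ, hτ0, hsol⟩ := exists_smooth_solution V hVs fun s c => by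
    simp [V, hypRot_zero_right, hβ0]
  let path : ℝ × ℝ → C(Unit01, (ℝ × ℝ) × ℝ) := fun p =>
    pairCLM Unit01 (ℝ × ℝ) ℝ (constCLM Unit01 (ℝ × ℝ) p, τ p)
  have hpath : ∀ {p}, ContDiffAt ℝ ∞ τ p → ContDiffAt ℝ ∞ path p := fun hp =>
    (pairCLM Unit01 (ℝ × ℝ) ℝ).contDiff.contDiffAt.comp _
      ((constCLM Unit01 (ℝ × ℝ)).contDiff.contDiffAt.prodMk hp)
  let H : C((ℝ × ℝ) × ℝ, ℝ × ℝ) := ⟨_, contDiff_hypRot.continuous⟩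
  have hHcont : ContinuousAt (fun p => H.comp (path p)) 0 :=
    (contDiff_comp_left H contDiff_hypRot).continuous.continuousAt.comp
      (hpath hτ.self_of_nhds).continuousAt
  have hH0 : H.comp (path 0) = 0 := by
    ext1 t
    exact hypRot_zero_right _
  -- The decomposition holds only near the origin. The constant path at the origin is the solution
  -- for `p = 0`, so for small `p` the whole path stays in this ball.
  obtain ⟨ε, hε, hball⟩ := Metric.eventually_nhds_iff_ball.1 hαβ
  have hsmall : ∀ᶠ p in 𝓝 0, ‖H.comp (path p)‖ < ε := by
    refine hHcont.norm.eventually_lt_const ?_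
    simpa only [hH0, norm_zero] using hε
  let B : ℝ × ℝ → C(Unit01, ℝ) := fun p => primitiveCLM (timeComp W (path p))
  refine ⟨fun p => τ p 1, fun p => Real.exp (-B p 1), ?_, ⟨?_, .of_forall fun p =>
    Real.exp_ne_zero _⟩, ?_⟩
  · filter_upwards [hτ] with p hp
    exact (ContinuousMap.evalCLM ℝ (1 : Unit01)).contDiff.contDiffAt.comp p hp
  · filter_upwards [hτ] with p hp
    have hB : ContDiffAt ℝ ∞ B p := primitiveCLM.contDiff.contDiffAt.comp p
      ((contDiff_timeComp W hWs).contDiffAt.comp p (hpath hp))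
    exact ((ContinuousMap.evalCLM ℝ (1 : Unit01)).contDiff.contDiffAt.comp p hB).neg.exp
  filter_upwards [hsol, hsmall] with p hp hps
  let v := timeComp V (path p)
  let w := timeComp W (path p)
  let T : ℝ → ℝ := fun t => ∫ s in (0 : ℝ)..t, extend01 v s
  let b : ℝ → ℝ := fun t => ∫ s in (0 : ℝ)..t, extend01 w s
  have hTτ : ∀ t : Unit01, T t = τ p t := fun t => (DFunLike.congr_fun hp t).symm
  -- `Y` satisfies `Y' = θ' α Y`, so `Y * exp (-b)` is constant; it equals `f p` at `s = 0`.
  let Y : ℝ → ℝ := fun s => f (hypRot (T s) p) +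
    θ s * (jet k f (hypRot (T s) p) - f (hypRot (T s) p))
  have hderiv : ∀ s ∈ Set.Icc (0 : ℝ) 1, HasDerivAt (fun s => Y s * Real.exp (-b s)) 0 s := by
    intro s hs
    have hTs : HasDerivAt T (V (s, p, T s)) s := by
      have h := hasDerivAt_integral_extend01 v s
      rw [extend01_coe v ⟨s, hs⟩] at h
      rw [hTτ ⟨s, hs⟩]
      exact h
    have hbs : HasDerivAt b (W (s, p, T s)) s := by
      have h := hasDerivAt_integral_extend01 w s
      rw [extend01_coe w ⟨s, hs⟩] at h
      rw [hTτ ⟨s, hs⟩]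
      exact h
    have hθs : HasDerivAt θ (deriv θ s) s := (hθ.differentiable (by simp) s).hasDerivAt
    have hfs := hasDerivAt_comp_hypRot hf p hTs
    have hδs := hasDerivAt_comp_hypRot ((contDiff_jet k f).sub hf) p hTs
    have hq : hypRot (T s) p ∈ Metric.ball (0 : ℝ × ℝ) ε := by
      rw [mem_ball_zero_iff, hTτ ⟨s, hs⟩]
      exact ((H.comp (path p)).norm_coe_le_norm ⟨s, hs⟩).trans_lt hps
    have hdec := hball _ hq s
    have hfd := hf.differentiable (by simp) (hypRot (T s) p)
    have hδd := ((contDiff_jet k f).sub hf).differentiable (by simp) (hypRot (T s) p)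
    rw [lieDeriv_add _ hfd (hδd.const_mul _), lieDeriv_const_mul _ _ hδd] at hdec
    have hY := hfs.add (hθs.mul hδs)
    refine (hY.mul hbs.neg.exp).congr_deriv ?_
    simp only [V, W, ContinuousMap.coe_mk, Pi.add_apply, Pi.mul_apply, Pi.neg_apply]
    linear_combination (deriv θ s * Real.exp (-b s)) * hdec
  have hconst := constant_of_has_deriv_right_zero
    (fun s hs => (hderiv s hs).continuousAt.continuousWithinAt)
    (fun s hs => (hderiv s (Set.Ico_subset_Icc_self hs)).hasDerivWithinAt) 1
    (Set.right_mem_Icc.2 zero_le_one)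
  have hT0 : T 0 = 0 := intervalIntegral.integral_same
  have hb0 : b 0 = 0 := intervalIntegral.integral_same
  have hT1 : T 1 = τ p 1 := hTτ 1
  have hb1 : b 1 = B p 1 := rfl
  have hθ0 : θ 0 = 0 := Real.smoothTransition.zero
  have hθ1 : θ 1 = 1 := Real.smoothTransition.one
  simp only [Y, hT0, hb0, hT1, hb1, hθ0, hθ1, hypRot_zero_left, zero_mul, one_mul, neg_zero,
    Real.exp_zero, mul_one, add_zero, add_sub_cancel] at hconst
  rw [← hconst, mul_comm]

/-! ### Conformal symmetries -/

/-- The map `(u, v) ↦ (c u, d v)` in the null coordinates `u = x + y`, `v = x - y`. -/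
def nullScale (c d : ℝ) : ℝ × ℝ →L[ℝ] ℝ × ℝ :=
  (((c + d) / 2) • ContinuousLinearMap.fst ℝ ℝ ℝ +
    ((c - d) / 2) • ContinuousLinearMap.snd ℝ ℝ ℝ).prod
    (((c - d) / 2) • ContinuousLinearMap.fst ℝ ℝ ℝ +
      ((c + d) / 2) • ContinuousLinearMap.snd ℝ ℝ ℝ)

theorem nullScale_apply (c d : ℝ) (p : ℝ × ℝ) : nullScale c d p =
    ((c + d) / 2 * p.1 + (c - d) / 2 * p.2, (c - d) / 2 * p.1 + (c + d) / 2 * p.2) := rfl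

theorem nullScale_comp (c d c' d' : ℝ) (p : ℝ × ℝ) :
    nullScale c d (nullScale c' d' p) = nullScale (c * c') (d * d') p := by
  ext <;> simp only [nullScale_apply] <;> ring

theorem nullScale_one : nullScale 1 1 = .id ℝ (ℝ × ℝ) := by
  ext <;> simp [nullScale_apply]

theorem nullScale_Xa2minus (c d : ℝ) (p : ℝ × ℝ) :
    nullScale c d (Xa2minus p) = Xa2minus (nullScale c d p) := by
  ext <;> simp only [nullScale_apply, Xa2minus] <;> ring

theorem hypRot_eq_nullScale (t : ℝ) (p : ℝ × ℝ) :
    hypRot t p = nullScale (Real.exp t) (Real.exp (-t)) p := by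
  ext <;> simp only [nullScale_apply, hypRot, Real.cosh_eq, Real.sinh_eq]

theorem isInvertible_nullScale {c d : ℝ} (hc : c ≠ 0) (hd : d ≠ 0) :
    (nullScale c d).IsInvertible :=
  ⟨ContinuousLinearEquiv.equivOfInverse (nullScale c d) (nullScale c⁻¹ d⁻¹)
    (fun p => by simp [nullScale_comp, hc, hd, nullScale_one])
    (fun p => by simp [nullScale_comp, hc, hd, nullScale_one]), rfl⟩

/-- In null coordinates `a` is half the differential of the product `u v`, which the scaling
multiplies by `c d`. -/
theorem a2minus_nullScale (c d : ℝ) (p w : ℝ × ℝ) :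
    a2minus (nullScale c d p) (nullScale c d w) = c * d * a2minus p w := by
  simp only [a2minus, nullScale_apply, sub_apply, smul_apply,
    ContinuousLinearMap.coe_fst', ContinuousLinearMap.coe_snd', smul_eq_mul]
  ring

theorem a2minus_Xa2minus (p : ℝ × ℝ) : a2minus p (Xa2minus p) = 0 := by
  simp only [a2minus, Xa2minus, sub_apply, smul_apply,
    ContinuousLinearMap.coe_fst', ContinuousLinearMap.coe_snd', smul_eq_mul]
  ring

/-- Motion along the trajectories of `Xa2minus` during the time `τ`, followed by a scaling of the
null coordinates. -/
def orbitMap (c d : ℝ) (τ : ℝ × ℝ → ℝ) (p : ℝ × ℝ) : ℝ × ℝ := nullScale c d (hypRot (τ p) p)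

theorem orbitMap_eq (c d : ℝ) (τ : ℝ × ℝ → ℝ) (p : ℝ × ℝ) :
    orbitMap c d τ p = nullScale (c * Real.exp (τ p)) (d * Real.exp (-τ p)) p := by
  rw [orbitMap, hypRot_eq_nullScale, nullScale_comp]

/-- The linear map with frozen time, plus the variation of the time, which moves the image point
along `X` because the scaling commutes with `X`. -/
theorem hasFDerivAt_orbitMap (c d : ℝ) {τ : ℝ × ℝ → ℝ} {p : ℝ × ℝ} (hτ : DifferentiableAt ℝ τ p) :
    HasFDerivAt (orbitMap c d τ) (nullScale (c * Real.exp (τ p)) (d * Real.exp (-τ p)) +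
      (fderiv ℝ τ p).smulRight (Xa2minus (orbitMap c d τ p))) p := by
  have h1 := hτ.hasFDerivAt.cosh
  have h2 := hτ.hasFDerivAt.sinh
  have hx : HasFDerivAt (fun q : ℝ × ℝ => q.1) (.fst ℝ ℝ ℝ) p := hasFDerivAt_fst
  have hy : HasFDerivAt (fun q : ℝ × ℝ => q.2) (.snd ℝ ℝ ℝ) p := hasFDerivAt_snd
  have h := (nullScale c d).hasFDerivAt.comp p
    (((h1.mul hx).add (h2.mul hy)).prodMk ((h2.mul hx).add (h1.mul hy)))
  refine h.congr_fderiv ?_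
  refine ContinuousLinearMap.ext fun w => ?_
  rw [orbitMap_eq]
  ext <;>
  · simp [nullScale_apply, Xa2minus, Real.cosh_eq, Real.sinh_eq]
    ring

theorem orbitMap_zero (c d : ℝ) (τ : ℝ × ℝ → ℝ) : orbitMap c d τ 0 = 0 := by
  rw [orbitMap, hypRot_zero_right, map_zero]

theorem Xa2minus_zero : Xa2minus 0 = 0 := rfl

theorem smoothNearZero_orbitMap (c d : ℝ) {τ : ℝ × ℝ → ℝ} (hτ : SmoothNearZero τ) :
    SmoothNearZero (orbitMap c d τ) := by
  filter_upwards [hτ] with p hp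
  exact (nullScale c d).contDiff.contDiffAt.comp p
    (contDiff_hypRot.contDiffAt.comp p (contDiffAt_id.prodMk hp))

theorem SmoothNearZero.isDiffeoGerm {φ : ℝ × ℝ → ℝ × ℝ} (hφ : SmoothNearZero φ) (h0 : φ 0 = 0)
    (hinv : (fderiv ℝ φ 0).IsInvertible) : IsDiffeoGerm φ := by
  obtain ⟨ψ, hψ0, hψ, hl, hr⟩ := exists_smooth_local_inverse hφ hinv
  rw [h0] at hψ0 hψ hr
  exact ⟨h0, hφ, ψ, hψ0, hψ, hl, hr⟩

/-- The rank-one term of the derivative points along `X`, which `a` kills, so `a` is only multiplied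
by `c d`. The same term gives `dφ(X) = (1 + X τ) X ∘ φ`, whence `h = γ (1 + X τ)`. -/
theorem orbitallyConjugate_of_eq_mul_comp_orbitMap {c d : ℝ} (hc : c ≠ 0) (hd : d ≠ 0)
    {f g τ γ : ℝ × ℝ → ℝ} (hτ : SmoothNearZero τ) (hγ : IsNonzeroFunction γ)
    (hfg : ∀ᶠ p in 𝓝 0, f p = γ p * g (orbitMap c d τ p)) :
    OrbitallyConjugate a2minus (fun p => f p • Xa2minus p) (fun p => g p • Xa2minus p) := by
  have hsm := smoothNearZero_orbitMap c d hτ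
  have hdiff : ∀ᶠ p in 𝓝 0, DifferentiableAt ℝ τ p :=
    hτ.mono fun p hp => hp.differentiableAt (by simp)
  have hce : ∀ p, c * Real.exp (τ p) ≠ 0 := fun p => mul_ne_zero hc (Real.exp_ne_zero _)
  have hde : ∀ p, d * Real.exp (-τ p) ≠ 0 := fun p => mul_ne_zero hd (Real.exp_ne_zero _)
  have hinv0 : (fderiv ℝ (orbitMap c d τ) 0).IsInvertible := by
    rw [(hasFDerivAt_orbitMap c d hdiff.self_of_nhds).fderiv, orbitMap_zero, Xa2minus_zero]
    simpa using isInvertible_nullScale (hce 0) (hde 0)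
  have hinv : ∀ᶠ p in 𝓝 0, (fderiv ℝ (orbitMap c d τ) p).IsInvertible := by
    obtain ⟨A, hA⟩ := hinv0
    have hcont : ContinuousAt (fderiv ℝ (orbitMap c d τ)) 0 :=
      (hsm.self_of_nhds.fderiv_right (m := ∞) (by simp)).continuousAt
    exact hcont (hA ▸ A.nhds)
  let σ : ℝ × ℝ → ℝ := fun p => 1 + lieDeriv Xa2minus τ p
  have hσ : SmoothNearZero σ := by
    filter_upwards [smooth_Xa2minus.lieDeriv hτ] with p hp
    exact contDiffAt_const.add hp
  have hσ0 : ∀ᶠ p in 𝓝 0, σ p ≠ 0 :=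
    hσ.self_of_nhds.continuousAt.eventually_ne (by simp [σ, lieDeriv_zero_apply])
  have hX : ∀ᶠ p in 𝓝 0, fderiv ℝ (orbitMap c d τ) p (Xa2minus p) =
      σ p • Xa2minus (orbitMap c d τ p) := by
    filter_upwards [hdiff] with p hp
    rw [(hasFDerivAt_orbitMap c d hp).fderiv, add_apply, nullScale_Xa2minus, ← orbitMap_eq,
      ContinuousLinearMap.smulRight_apply, add_smul, one_smul]
    rfl
  refine ⟨orbitMap c d τ, ⟨hsm.isDiffeoGerm (orbitMap_zero c d τ) hinv0, fun _ => (c * d)⁻¹,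
    ⟨contDiff_const.smoothNearZero, .of_forall fun _ => inv_ne_zero (mul_ne_zero hc hd)⟩, ?_⟩,
    fun p => γ p * σ p, ⟨?_, ?_⟩, ?_⟩
  · filter_upwards [hdiff] with p hp
    refine ContinuousLinearMap.ext fun w => ?_
    rw [pullbackForm, (hasFDerivAt_orbitMap c d hp).fderiv, smul_apply,
      ContinuousLinearMap.comp_apply, add_apply, map_add,
      ContinuousLinearMap.smulRight_apply, map_smul, a2minus_Xa2minus, smul_zero, add_zero,
      orbitMap_eq, a2minus_nullScale, smul_eq_mul, Real.exp_neg]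
    field_simp
  · filter_upwards [hγ.1, hσ] with p h1 h2 using h1.mul h2
  · filter_upwards [hγ.2, hσ0] with p h1 h2 using mul_ne_zero h1 h2
  · filter_upwards [hinv, hX, hfg, hσ0] with p h1 h2 h3 h4
    obtain ⟨A, hA⟩ := h1
    rw [VectorField.pullback, ← hA, ContinuousLinearMap.inverse_equiv]
    rw [← hA] at h2
    have h5 : A.symm (Xa2minus (orbitMap c d τ p)) = (σ p)⁻¹ • Xa2minus p := by
      rw [ContinuousLinearEquiv.symm_apply_eq, map_smul]
      have h6 : A (Xa2minus p) = σ p • Xa2minus (orbitMap c d τ p) := h2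
      rw [h6, inv_smul_smul₀ h4]
    have h7 : (A.symm : ℝ × ℝ →L[ℝ] ℝ × ℝ)
        (g (orbitMap c d τ p) • Xa2minus (orbitMap c d τ p)) =
        g (orbitMap c d τ p) • (σ p)⁻¹ • Xa2minus p := by
      rw [map_smul]
      exact congrArg _ h5
    rw [h7, h3, smul_smul, smul_smul]
    congr 1
    field_simp

theorem orbitMap_one_one (τ : ℝ × ℝ → ℝ) (p : ℝ × ℝ) :
    orbitMap 1 1 τ p = hypRot (τ p) p := by
  rw [orbitMap, nullScale_one, ContinuousLinearMap.id_apply]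

/-! ### The normal forms -/

theorem isFirstIntegral_sq_sub_sq (f : ℝ × ℝ → ℝ) :
    IsFirstIntegral (fun p => f p • Xa2minus p) (fun p => p.1 ^ 2 - p.2 ^ 2) := by
  refine .of_forall fun p => ?_
  have hx : HasFDerivAt (fun q : ℝ × ℝ => q.1) (.fst ℝ ℝ ℝ) p := hasFDerivAt_fst
  have hy : HasFDerivAt (fun q : ℝ × ℝ => q.2) (.snd ℝ ℝ ℝ) p := hasFDerivAt_snd
  have h : HasFDerivAt (fun p : ℝ × ℝ => p.1 ^ 2 - p.2 ^ 2) _ p := (hx.pow 2).sub (hy.pow 2)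
  rw [lieDeriv, h.fderiv]
  simp [Xa2minus]
  ring

theorem SmoothNearZero.orbitallyConjugate_Xa2minus {f : ℝ × ℝ → ℝ} (hf : SmoothNearZero f)
    (h0 : f 0 ≠ 0) :
    OrbitallyConjugate a2minus (fun p => f p • Xa2minus p) Xa2minus := by
  have h := orbitallyConjugate_of_eq_mul_comp_orbitMap (f := f) (g := fun _ => 1)
    one_ne_zero one_ne_zero (contDiff_const (c := (0 : ℝ))).smoothNearZero
    ⟨hf, (SmoothNearZero.contDiffAt_zero hf).continuousAt.eventually_ne h0⟩
    (.of_forall fun _ => (mul_one _).symm)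
  simpa using h

theorem fderiv_mul_zero {f h : ℝ × ℝ → ℝ} (hf : SmoothNearZero f) (hh : SmoothNearZero h)
    (h0 : f 0 = 0) : fderiv ℝ (fun p => h p * f p) 0 = h 0 • fderiv ℝ f 0 := by
  rw [fderiv_fun_mul (hh.self_of_nhds.differentiableAt (by simp))
    (hf.self_of_nhds.differentiableAt (by simp)), h0, zero_smul, add_zero]

/-- If `f 0 = 0`, the origin is the only zero of `f`, so `x` and `y` are both multiples of `f`; then
`dx` and `dy` at the origin would both be multiples of `df`. -/
theorem ne_zero_of_hasPropertyOfZeros {f : ℝ × ℝ → ℝ} (hf : SmoothNearZero f)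
    (hz : HasPropertyOfZeros f) (hone : HasOnlyOneZero fun p => f p • Xa2minus p) : f 0 ≠ 0 := by
  intro h0
  have hzero : ∀ᶠ p in 𝓝 0, f p = 0 → p = 0 := by
    filter_upwards [hone] with p hp h
    exact hp.1 (by simp [h])
  obtain ⟨a, ha, hfa⟩ := hz Prod.fst contDiff_fst.smoothNearZero
    (hzero.mono fun p hp h => by rw [hp h]; rfl)
  obtain ⟨b, hb, hfb⟩ := hz Prod.snd contDiff_snd.smoothNearZero
    (hzero.mono fun p hp h => by rw [hp h]; rfl)
  have ha' := (EventuallyEq.fderiv_eq (𝕜 := ℝ) hfa).symm.trans fderiv_fst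
  have hb' := (EventuallyEq.fderiv_eq (𝕜 := ℝ) hfb).symm.trans fderiv_snd
  rw [fderiv_mul_zero hf ha h0] at ha'
  rw [fderiv_mul_zero hf hb h0] at hb'
  have h1 := DFunLike.congr_fun ha' (1, 0)
  have h2 := DFunLike.congr_fun ha' (0, 1)
  have h3 := DFunLike.congr_fun hb' (0, 1)
  simp only [smul_apply, smul_eq_mul, ContinuousLinearMap.coe_fst',
    ContinuousLinearMap.coe_snd'] at h1 h2 h3
  rcases mul_eq_zero.1 h2 with h | h
  · simp [h] at h1
  · simp [h] at h3

theorem codim_eq_zero_of_ne_zero {f : ℝ × ℝ → ℝ} (hf : SmoothNearZero f) (h0 : f 0 ≠ 0) :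
    codim Xa2minus smooth_Xa2minus f hf = 0 := by
  have h : tangentIdeal Xa2minus smooth_Xa2minus f hf = ⊤ :=
    Ideal.eq_top_of_isUnit_mem _ (Ideal.subset_span (Set.mem_insert _ _))
      (isUnit_of_evalZero_ne_zero (g := germ f hf) h0)
  have : Subsingleton (smoothGerms ⧸ tangentIdeal Xa2minus smooth_Xa2minus f hf) :=
    Ideal.Quotient.subsingleton_iff.2 h
  exact rank_subsingleton' ℝ _

theorem hasFDerivAt_Xa2minus (p : ℝ × ℝ) : HasFDerivAt Xa2minus
    ((ContinuousLinearMap.snd ℝ ℝ ℝ).prod (ContinuousLinearMap.fst ℝ ℝ ℝ)) p :=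
  hasFDerivAt_snd.prodMk hasFDerivAt_fst

theorem IsDiffeoGerm.fderiv_leftInverse {φ : ℝ × ℝ → ℝ × ℝ} (hφ : IsDiffeoGerm φ) :
    ∃ ψ : ℝ × ℝ → ℝ × ℝ, ∀ᶠ p in 𝓝 0, ∀ v, fderiv ℝ ψ (φ p) (fderiv ℝ φ p v) = v ∧
      fderiv ℝ φ p (fderiv ℝ ψ (φ p) v) = v := by
  obtain ⟨h0, hs, ψ, hψ0, hψ, hl, hr⟩ := hφ
  have htend : Tendsto φ (𝓝 0) (𝓝 0) := by
    have := hs.self_of_nhds.continuousAt.tendsto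
    rwa [h0] at this
  refine ⟨ψ, ?_⟩
  filter_upwards [hs, htend.eventually hψ, hl.eventually_nhds, hl,
    htend.eventually hr.eventually_nhds] with p h1 h2 h3 h4 h5 v
  have hd1 := (h1.differentiableAt (by simp)).hasFDerivAt
  have hd2 := (h2.differentiableAt (by simp)).hasFDerivAt
  constructor
  · have h := (hd2.comp p hd1).congr_of_eventuallyEq (f₁ := id) (h3.mono fun q hq => hq.symm)
    exact DFunLike.congr_fun (h.unique (hasFDerivAt_id p)) v
  · rw [← h4] at hd1
    have h := (hd1.comp (φ p) hd2).congr_of_eventuallyEq (f₁ := id) (h5.mono fun q hq => hq.symm)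
    have h' := DFunLike.congr_fun (h.unique (hasFDerivAt_id (φ p))) v
    rw [h4] at h'
    exact h'

/-- If `f 0 = 0`, the field `f X` has zero linear part at the origin, whereas that of `X` is
invertible. -/
theorem ne_zero_of_orbitallyConjugate {f : ℝ × ℝ → ℝ} (hf : SmoothNearZero f)
    (hconj : OrbitallyConjugate a2minus (fun p => f p • Xa2minus p) Xa2minus) : f 0 ≠ 0 := by
  intro hf0
  obtain ⟨φ, ⟨hφ, -⟩, h, ⟨hh, hh0⟩, heq⟩ := hconj
  obtain ⟨ψ, hψ⟩ := hφ.fderiv_leftInverse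
  obtain ⟨hφ0, hφs, -⟩ := hφ
  -- The push-forward form of the relation avoids differentiating the inverse of `fderiv ℝ φ p`.
  have hpush : ∀ᶠ p in 𝓝 0, f p • fderiv ℝ φ p (Xa2minus p) = h p • Xa2minus (φ p) := by
    filter_upwards [heq, hψ] with p hp hi
    let A := ContinuousLinearEquiv.equivOfInverse (fderiv ℝ φ p) (fderiv ℝ ψ (φ p))
      (fun v => (hi v).1) (fun v => (hi v).2)
    have hA : fderiv ℝ φ p = A := rfl
    rw [VectorField.pullback, hA, ContinuousLinearMap.inverse_equiv] at hp
    rw [← map_smul, hp, map_smul, hA]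
    congr 1
    exact A.apply_symm_apply _
  have hfd : HasFDerivAt f (fderiv ℝ f 0) 0 :=
    (hf.self_of_nhds.differentiableAt (by simp)).hasFDerivAt
  have hhd : HasFDerivAt h (fderiv ℝ h 0) 0 :=
    (hh.self_of_nhds.differentiableAt (by simp)).hasFDerivAt
  have hφd : HasFDerivAt φ (fderiv ℝ φ 0) 0 :=
    (hφs.self_of_nhds.differentiableAt (by simp)).hasFDerivAt
  have hφ2 : HasFDerivAt (fderiv ℝ φ) (fderiv ℝ (fderiv ℝ φ) 0) 0 :=
    ((hφs.self_of_nhds.fderiv_right (m := ∞) (by simp)).differentiableAt (by simp)).hasFDerivAt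
  have hleft := hfd.smul (hφ2.clm_apply (hasFDerivAt_Xa2minus 0))
  have hright := hhd.smul ((hasFDerivAt_Xa2minus (φ 0)).comp 0 hφd)
  have huniq := hleft.unique (hright.congr_of_eventuallyEq hpush)
  have hval : ∀ v, Xa2minus (fderiv ℝ φ 0 v) = 0 := by
    intro v
    have h1 : h 0 • Xa2minus (fderiv ℝ φ 0 v) = 0 := by
      have := DFunLike.congr_fun huniq v
      simp [hf0, Xa2minus_zero, hφ0] at this
      exact this.symm
    exact (smul_eq_zero.1 h1).resolve_left hh0.self_of_nhds
  have h1 : fderiv ℝ φ 0 (1, 0) = 0 := by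
    have := hval (1, 0)
    exact Prod.ext (congrArg Prod.snd this) (congrArg Prod.fst this)
  have h2 := (hψ.self_of_nhds (1, 0)).1
  rw [h1, map_zero] at h2
  simpa using congrArg Prod.fst h2

theorem exists_eq_mul_jet_hypRot_of_germ {f : ℝ × ℝ → ℝ} (hf : SmoothNearZero f) {k : ℕ}
    (hk : codim Xa2minus smooth_Xa2minus f hf = k) :
    ∃ τ γ : ℝ × ℝ → ℝ, SmoothNearZero τ ∧ IsNonzeroFunction γ ∧
      ∀ᶠ p in 𝓝 0, f p = γ p * jet k f (hypRot (τ p) p) := by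
  obtain ⟨g, hg, hgf⟩ := hf.exists_contDiff
  have hgerm : germ g hg.smoothNearZero = germ f hf := Subtype.ext (Germ.coe_eq.2 hgf)
  have hgerm' : germ (lieDeriv Xa2minus g) (smooth_Xa2minus.lieDeriv hg.smoothNearZero) =
      germ (lieDeriv Xa2minus f) (smooth_Xa2minus.lieDeriv hf) := by
    refine Subtype.ext (Germ.coe_eq.2 ?_)
    filter_upwards [hgf.fderiv (𝕜 := ℝ)] with p hp
    rw [lieDeriv, lieDeriv, hp]
  have hideal : tangentIdeal Xa2minus smooth_Xa2minus g hg.smoothNearZero =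
      tangentIdeal Xa2minus smooth_Xa2minus f hf := by
    rw [tangentIdeal, tangentIdeal, hgerm, hgerm']
  have hk' : codim Xa2minus smooth_Xa2minus g hg.smoothNearZero = k := by
    rw [← hk, codim, codim, hideal]
  obtain ⟨τ, γ, hτ, hγ, h⟩ := exists_eq_mul_jet_hypRot hg hk'
  refine ⟨τ, γ, hτ, hγ, ?_⟩
  filter_upwards [h, hgf] with p hp hpf
  rw [← hpf, hp, jet_congr hgf]

/-- In codimension `1` each null coordinate lies in `⟨f, X f⟩`. Along `nullVec i`, the derivatives
of `f` and `X f` at the origin agree up to sign; if they vanished, so would that of every element of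
the ideal, but the null coordinate has derivative `1`. -/
theorem fderiv_nullVec_ne_zero {f : ℝ × ℝ → ℝ} (hf : SmoothNearZero f) (hf0 : f 0 = 0)
    (hk : codim Xa2minus smooth_Xa2minus f hf = 1) (i : Fin 2) :
    fderiv ℝ f 0 (nullVec i) ≠ 0 := by
  intro hzero
  obtain ⟨a, b, ha, hb, hab⟩ := exists_nullMonomial_eq hf (k := 1) (by simpa using hk)
    (fun _ => i)
  have hmono : (nullMonomial fun _ : Fin 1 => i) = nullCoord i := by
    ext p
    simp [nullMonomial]
  rw [hmono] at hab
  have hfd : DifferentiableAt ℝ f 0 := hf.self_of_nhds.differentiableAt (by simp)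
  have hL := smooth_Xa2minus.lieDeriv hf
  have hf2 : HasFDerivAt (fderiv ℝ f) (fderiv ℝ (fderiv ℝ f) 0) 0 :=
    ((hf.self_of_nhds.fderiv_right (m := ∞) (by simp)).differentiableAt (by simp)).hasFDerivAt
  have hLd : fderiv ℝ (lieDeriv Xa2minus f) 0 (nullVec i) =
      nullWeight i * fderiv ℝ f 0 (nullVec i) := by
    have h := hf2.clm_apply (hasFDerivAt_Xa2minus 0)
    have h' : HasFDerivAt (lieDeriv Xa2minus f) _ 0 := h
    rw [h'.fderiv, ← smul_eq_mul, ← map_smul]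
    have hX : (ContinuousLinearMap.snd ℝ ℝ ℝ).prod (ContinuousLinearMap.fst ℝ ℝ ℝ) (nullVec i) =
        nullWeight i • nullVec i := by
      fin_cases i <;> ext <;> norm_num [nullVec, nullWeight]
    simp [Xa2minus_zero, ← hX]
  have heq := DFunLike.congr_fun (EventuallyEq.fderiv_eq (𝕜 := ℝ) hab) (nullVec i)
  have hd1 : DifferentiableAt ℝ (fun p => a p * f p) 0 :=
    (ha.differentiable (by simp) 0).mul hfd
  have hd2 : DifferentiableAt ℝ (fun p => b p * lieDeriv Xa2minus f p) 0 :=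
    (hb.differentiable (by simp) 0).mul (hL.self_of_nhds.differentiableAt (by simp))
  rw [fderiv_fun_add hd1 hd2, fderiv_mul_zero hf ha.smoothNearZero hf0,
    fderiv_mul_zero hL hb.smoothNearZero (lieDeriv_zero_apply f)] at heq
  simp only [add_apply, smul_apply, hLd, hzero, mul_zero, smul_zero,
    add_zero] at heq
  fin_cases i
  · have h : HasFDerivAt (nullCoord 0) (.fst ℝ ℝ ℝ + .snd ℝ ℝ ℝ) 0 :=
      hasFDerivAt_fst.add hasFDerivAt_snd
    norm_num [h.fderiv, nullVec] at heq
  · have h : HasFDerivAt (nullCoord 1) (.fst ℝ ℝ ℝ - .snd ℝ ℝ ℝ) 0 :=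
      hasFDerivAt_fst.sub hasFDerivAt_snd
    norm_num [h.fderiv, nullVec] at heq

/-- A linear form is `x` after scaling the null coordinates, because `x` is half their sum; this
explains the factors `2`. -/
theorem jet_one_eq {f : ℝ × ℝ → ℝ} (hf0 : f 0 = 0) (p : ℝ × ℝ) :
    jet 1 f p = (nullScale (2 * fderiv ℝ f 0 (nullVec 0)) (2 * fderiv ℝ f 0 (nullVec 1)) p).1 := by
  have h : jet 1 f p = fderiv ℝ f 0 p := by
    simp [jet, Finset.sum_range_succ, hf0]
  rw [h]
  conv_lhs => rw [← sum_nullCoord_smul_nullVec p]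
  rw [map_sum]
  simp only [Fin.sum_univ_two, map_smul, smul_eq_mul, nullScale_apply]
  simp only [nullCoord, Matrix.cons_val_zero, Matrix.cons_val_one]
  ring

end

end PlanarGerm

theorem mainTheorem9 :
    -- every member of the kernel has the first integral `x² - y²`
    (∀ f : ℝ × ℝ → ℝ, PlanarGerm.SmoothNearZero f →
      PlanarGerm.IsFirstIntegral (fun p => f p • PlanarGerm.Xa2minus p)
        (fun p => p.1 ^ 2 - p.2 ^ 2)) ∧
    -- (1) only one zero
    (∀ f : ℝ × ℝ → ℝ, PlanarGerm.SmoothNearZero f → PlanarGerm.HasPropertyOfZeros f →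
      PlanarGerm.HasOnlyOneZero (fun p => f p • PlanarGerm.Xa2minus p) →
      PlanarGerm.OrbitallyConjugate PlanarGerm.a2minus
        (fun p => f p • PlanarGerm.Xa2minus p) PlanarGerm.Xa2minus) ∧
    -- the class in (1) has codimension 0
    (∀ (f : ℝ × ℝ → ℝ) (hf : PlanarGerm.SmoothNearZero f),
      PlanarGerm.OrbitallyConjugate PlanarGerm.a2minus
        (fun p => f p • PlanarGerm.Xa2minus p) PlanarGerm.Xa2minus →
      PlanarGerm.codim PlanarGerm.Xa2minus PlanarGerm.smooth_Xa2minus f hf = 0) ∧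
    -- (2) regular curve of zeros, codimension 1
    (∀ (f : ℝ × ℝ → ℝ) (hf : PlanarGerm.SmoothNearZero f),
      PlanarGerm.IsRegularCurve f →
      PlanarGerm.codim PlanarGerm.Xa2minus PlanarGerm.smooth_Xa2minus f hf = 1 →
      PlanarGerm.OrbitallyConjugate PlanarGerm.a2minus
        (fun p => f p • PlanarGerm.Xa2minus p) (fun p => p.1 • PlanarGerm.Xa2minus p)) ∧
    -- (3) finite codimension `k`
    (∀ (f : ℝ × ℝ → ℝ) (hf : PlanarGerm.SmoothNearZero f) (k : ℕ),
      PlanarGerm.codim PlanarGerm.Xa2minus PlanarGerm.smooth_Xa2minus f hf = (k : Cardinal) →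
      PlanarGerm.OrbitallyConjugate PlanarGerm.a2minus
        (fun p => f p • PlanarGerm.Xa2minus p)
        (fun p => PlanarGerm.jet k f p • PlanarGerm.Xa2minus p)) := by
  refine ⟨fun f _ => PlanarGerm.isFirstIntegral_sq_sub_sq f,
    fun f hf hz hone => hf.orbitallyConjugate_Xa2minus
      (PlanarGerm.ne_zero_of_hasPropertyOfZeros hf hz hone),
    fun f hf hconj => PlanarGerm.codim_eq_zero_of_ne_zero hf
      (PlanarGerm.ne_zero_of_orbitallyConjugate hf hconj), fun f hf hreg hk => ?_,
    fun f hf k hk => ?_⟩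
  · obtain ⟨τ, γ, hτ, hγ, h⟩ := PlanarGerm.exists_eq_mul_jet_hypRot_of_germ hf (k := 1)
      (by simpa using hk)
    refine PlanarGerm.orbitallyConjugate_of_eq_mul_comp_orbitMap
      (mul_ne_zero two_ne_zero (PlanarGerm.fderiv_nullVec_ne_zero hf hreg.1 hk 0))
      (mul_ne_zero two_ne_zero (PlanarGerm.fderiv_nullVec_ne_zero hf hreg.1 hk 1)) hτ hγ ?_
    filter_upwards [h] with p hp
    rw [hp, PlanarGerm.jet_one_eq hreg.1]
    rfl
  · obtain ⟨τ, γ, hτ, hγ, h⟩ := PlanarGerm.exists_eq_mul_jet_hypRot_of_germ hf hk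
    refine PlanarGerm.orbitallyConjugate_of_eq_mul_comp_orbitMap one_ne_zero one_ne_zero hτ hγ ?_
    filter_upwards [h] with p hp
    rw [hp, PlanarGerm.orbitMap_one_one]
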